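/- Let $k$ be a $\sigma$-field, i.e. a field (of arbitrary characteristic) with an endomorphism $\sigma\colon k\to k$. A $k$-$\sigma$-algebra is a commutative $k$-algebra $S$ with a ring endomorphism $\sigma\colon S\to S$ such that $k\to S$ commutes with $\sigma$; morphisms are the $k$-algebra morphisms that commute with $\sigma$. A group $k$-$\sigma$-scheme $G$ is a functor from $k$-$\sigma$-algebras to groups whose underlying functor to sets is representable, $G\simeq\operatorname{Alg}_k^\sigma(k\{G\},-)$ for a $k$-$\sigma$-algebra $k\{G\}$; morphisms of group $k$-$\sigma$-schemes are morphisms of functors to groups. A normal $\sigma$-closed subgroup $N\trianglelefteq G$ is a subfunctor $N\subset G$ such that $N(S)$ is a normal subgroup of $G(S)$ for every $k$-$\sigma$-algebra $S$ and such that, for some ideal $I$ of $k\{G\}$ with $\sigma(I)\subset I$, there is an isomorphism $N\simeq\operatorname{Alg}_k^\sigma(k\{G\}/I,-)$ compatible with the inclusions into $G\simeq\operatorname{Alg}_k^\sigma(k\{G\},-)$. The kernel of a morphism $\phi\colon G\to H$ of group $k$-$\sigma$-schemes is given by $\ker(\phi)(S)=\ker(\phi(S))$. A quotient of $G$ modulo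 $N$ is a morphism $\pi\colon G\to G/N$ of group $k$-$\sigma$-schemes with $N\subset\ker(\pi)$ such that for every morphism $\phi\colon G\to H$ of group $k$-$\sigma$-schemes with $N\subset\ker(\phi)$ there is a unique morphism $\psi\colon G/N\to H$ of group $k$-$\sigma$-schemes with $\psi\circ\pi=\phi$. **Theorem.** Let $G$ be a group $k$-$\sigma$-scheme and $N\trianglelefteq G$ a normal $\sigma$-closed subgroup. Then a quotient of $G$ modulo $N$ exists, and every quotient $\pi\colon G\to G/N$ of $G$ modulo $N$ satisfies $N=\ker(\pi)$. -/

import Mathlib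

open CategoryTheory Opposite

universe u

namespace DifferenceAlgebra

/-- A difference ring structure (`σ`-ring): a ring together with a ring endomorphism `σ`, which
is not assumed to be injective or surjective. -/
class SigmaRing (R : Type u) [CommRing R] where
  /-- The distinguished endomorphism. -/
  sigma : R →+* R

/-- The distinguished endomorphism of a difference ring. -/
def σ {R : Type u} [CommRing R] [SigmaRing R] : R →+* R := SigmaRing.sigma

/-- A `k`-`σ`-algebra over a `σ`-field `k`: a commutative `k`-algebra with an endomorphism `σ`
such that the structure map commutes with `σ`. -/
structure SigmaAlg (k : Type u) [Field k] [SigmaRing k] where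
  /-- The underlying type. -/
  carrier : Type u
  [commRing : CommRing carrier]
  [algebra : Algebra k carrier]
  [sigmaRing : SigmaRing carrier]
  sigma_algebraMap : ∀ c : k, σ (algebraMap k carrier c) = algebraMap k carrier (σ c)

variable {k : Type u} [Field k] [SigmaRing k]

namespace SigmaAlg

instance : CoeSort (SigmaAlg k) (Type u) := ⟨carrier⟩

attribute [instance] commRing algebra sigmaRing

/-- Morphisms of `k`-`σ`-algebras: `k`-algebra morphisms commuting with `σ`. -/
@[ext]
structure Hom (R S : SigmaAlg k) where
  /-- The underlying `k`-algebra morphism. -/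
  toAlgHom : R →ₐ[k] S
  map_sigma : ∀ r : R, toAlgHom (σ r) = σ (toAlgHom r)

/-- The category of `k`-`σ`-algebras. -/
instance : Category (SigmaAlg k) where
  Hom R S := Hom R S
  id R := ⟨AlgHom.id k R, fun _ => rfl⟩
  comp f g := ⟨g.toAlgHom.comp f.toAlgHom, fun r => by
    simp [f.map_sigma, g.map_sigma]⟩

end SigmaAlg

/-- A `σ`-ideal: an ideal stable under `σ`. -/
structure SigmaIdeal (R : SigmaAlg k) where
  /-- The underlying ideal. -/
  ideal : Ideal R
  sigma_mem : ∀ r ∈ ideal, σ r ∈ ideal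

namespace SigmaIdeal

variable {R : SigmaAlg k} (I : SigmaIdeal R)

/-- The endomorphism of `R / I` induced by `σ`. -/
instance : SigmaRing (R ⧸ I.ideal) where
  sigma := Ideal.quotientMap I.ideal σ (fun r hr => I.sigma_mem r hr)

/-- The quotient `k`-`σ`-algebra `R / I`. -/
def quotient : SigmaAlg k where
  carrier := R ⧸ I.ideal
  sigma_algebraMap c := congrArg (Ideal.Quotient.mk I.ideal) (R.sigma_algebraMap c)

/-- The projection `R → R / I` as a morphism of `k`-`σ`-algebras. -/
def proj : R ⟶ I.quotient where
  toAlgHom := Ideal.Quotient.mkₐ k I.ideal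
  map_sigma _ := rfl

end SigmaIdeal

/-- A `σ`-closed `σ`-subscheme `Y` of a `k`-`σ`-scheme `X`, that is, of a functor from
`k`-`σ`-algebras to sets which is representable by a `k`-`σ`-algebra `k{X}`: the subfunctor `Y`
is represented by `k{X} / I` for some `σ`-ideal `I` of `k{X}`, compatibly with the inclusion into
`X ≃ Alg(k{X}, -)`. Here `k{X}` is `X.coreprX`, and `X.coreprW` is the isomorphism
`Alg(k{X}, -) ≃ X`. -/
def IsSigmaClosed (X : SigmaAlg k ⥤ Type u) [X.IsCorepresentable] (Y : Subfunctor X) : Prop :=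
  ∃ (I : SigmaIdeal X.coreprX) (e : Y.toFunctor ≅ coyoneda.obj (op I.quotient)),
    Y.ι ≫ X.coreprW.inv = e.hom ≫ coyoneda.map I.proj.op

variable (k) in
/-- A group `k`-`σ`-scheme: a functor from `k`-`σ`-algebras to groups whose underlying functor to
sets is representable by a `k`-`σ`-algebra. A morphism of group `k`-`σ`-schemes `G → H` is a
natural transformation `G.toFunctor ⟶ H.toFunctor` of functors to groups. -/
structure GroupSigmaScheme where
  /-- The functor of points. -/
  toFunctor : SigmaAlg k ⥤ GrpCat.{u}
  isCorepresentable : (toFunctor ⋙ forget GrpCat.{u}).IsCorepresentable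

namespace GroupSigmaScheme

attribute [instance] isCorepresentable

/-- The underlying `k`-`σ`-scheme of a group `k`-`σ`-scheme. -/
abbrev points (G : GroupSigmaScheme k) : SigmaAlg k ⥤ Type u :=
  G.toFunctor ⋙ forget GrpCat.{u}

end GroupSigmaScheme

/-- A subfunctor of a group `k`-`σ`-scheme `G` with values in subgroups. -/
@[ext]
structure SubgroupOf (G : GroupSigmaScheme k) where
  /-- The subgroup of `G(S)`. -/
  obj : ∀ S : SigmaAlg k, Subgroup (G.toFunctor.obj S)
  map_mem : ∀ {S T : SigmaAlg k} (f : S ⟶ T), ∀ g ∈ obj S, (G.toFunctor.map f).hom g ∈ obj T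

namespace SubgroupOf

variable {G : GroupSigmaScheme k}

/-- `N ⊆ M` if `N(S) ⊆ M(S)` for every `k`-`σ`-algebra `S`. -/
instance : LE (SubgroupOf G) := ⟨fun N M => ∀ S, N.obj S ≤ M.obj S⟩

/-- The underlying subfunctor of the functor of points of `G`. -/
def toSubfunctor (N : SubgroupOf G) : Subfunctor G.points where
  obj S := {g | g ∈ N.obj S}
  map f g hg := N.map_mem f g hg

/-- `N` is a normal `σ`-closed subgroup of `G`: it is a `σ`-closed `σ`-subscheme of `G`, and
`N(S)` is a normal subgroup of `G(S)` for every `k`-`σ`-algebra `S`. -/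
structure IsNormalSigmaClosed (N : SubgroupOf G) : Prop where
  isSigmaClosed : IsSigmaClosed G.points N.toSubfunctor
  normal : ∀ S : SigmaAlg k, (N.obj S).Normal

end SubgroupOf

/-- The kernel of a morphism of group `k`-`σ`-schemes: `ker(φ)(S) = ker(φ(S))`. -/
def kernel {G H : GroupSigmaScheme k} (φ : G.toFunctor ⟶ H.toFunctor) : SubgroupOf G where
  obj S := (φ.app S).hom.ker
  map_mem {S T} f g hg := by
    have hg' : (φ.app S).hom g = 1 := hg
    have h := ConcreteCategory.congr_hom (φ.naturality f) g
    change (φ.app T).hom ((G.toFunctor.map f).hom g) =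
      (H.toFunctor.map f).hom ((φ.app S).hom g) at h
    change (φ.app T).hom ((G.toFunctor.map f).hom g) = 1
    rw [h, hg', map_one]

/-- `π : G → Q` is a quotient of `G` modulo `N`: `N ⊆ ker(π)`, and every morphism `φ : G → H` of
group `k`-`σ`-schemes with `N ⊆ ker(φ)` factors uniquely through `π`. -/
structure IsQuotient {G : GroupSigmaScheme k} (N : SubgroupOf G) {Q : GroupSigmaScheme k}
    (π : G.toFunctor ⟶ Q.toFunctor) : Prop where
  le_kernel : N ≤ kernel π
  existsUnique_factor : ∀ (H : GroupSigmaScheme k) (φ : G.toFunctor ⟶ H.toFunctor),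
    N ≤ kernel φ → ∃! ψ : Q.toFunctor ⟶ H.toFunctor, π ≫ ψ = φ

end DifferenceAlgebra

/-! Forgetting `σ`, the coordinate ring A = k{G} is a commutative Hopf algebra. The ideal I of N
cuts out a normal subgroup of the points in every k-algebra, not only in difference algebras: the
conditions need checking only at generic points, and these live over k, A/I, A/I ⊗ A/I and A ⊗ A/I,
which all carry `σ` (`isNormalIdeal`).

Let B be the algebra of functions on G invariant under right translation by N. Normality and
flatness over k make B a Hopf subalgebra (`comul_invariants`, `antipode_mem_invariants`). Invariance
is a single equation at the generic pair, and `σ` respects it, so B is `σ`-stable. The quotient is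
represented by B, because the dual of a morphism that kills N takes values in B.

The hard point is that the kernel is no larger than N, i.e. that I lies in the ideal J generated by
the invariants with counit 0 (`le_span_invariants`). The argument is of Chevalley type. An f in I
lies in a finite-dimensional right coideal V, and N stabilizes V ∩ I. The maximal minors of the
columns belonging to V ∩ I in the matrix of the representation (Plücker coordinates of the
translates of V ∩ I) are semi-invariants with a common weight. Normality provides a function h of
inverse weight (`exists_inverse_weight`). Each product of a minor with h is invariant, hence
constant modulo J. Cramer's rule then shows that the entries leading out of V ∩ I vanish modulo J,
and so V ∩ I lies in J.

Finally, the projection constructed here factors through any other quotient, whose kernel is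
therefore also contained in N. -/

open scoped TensorProduct

/-! ### Linear algebra of tensors and finiteness for comodules -/

section LinearAlgebra

variable {k : Type*} [Field k] {V W : Type*} [AddCommGroup V] [Module k V] [AddCommGroup W]
  [Module k W]

theorem LinearIndependent.exists_dual_family {ι : Type*} [DecidableEq ι] {e : ι → V}
    (he : LinearIndependent k e) :
    ∃ φ : ι → Module.Dual k V, ∀ i j, φ i (e j) = if j = i then 1 else 0 := by
  obtain ⟨g, hg⟩ := LinearMap.exists_leftInverse_of_injective (Finsupp.linearCombination k e)
    (LinearMap.ker_eq_bot.mpr he)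
  refine ⟨fun i => Finsupp.lapply i ∘ₗ g, fun i j => ?_⟩
  have h := LinearMap.congr_fun hg (Finsupp.single j 1)
  simp only [LinearMap.comp_apply, Finsupp.linearCombination_single, one_smul,
    LinearMap.id_apply] at h
  simp [h, Finsupp.single_apply]

theorem LinearIndependent.tmul_left_injective {ι : Type*} [Fintype ι] {e : ι → V}
    (he : LinearIndependent k e) {z w : ι → W} (h : ∑ i, e i ⊗ₜ[k] z i = ∑ i, e i ⊗ₜ[k] w i) :
    z = w := by
  classical
  obtain ⟨φ, hφ⟩ := he.exists_dual_family
  funext i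
  have := congrArg (fun x => TensorProduct.lid k W ((φ i).rTensor W x)) h
  simpa [hφ] using this

theorem LinearIndependent.tmul_right_injective {ι : Type*} [Fintype ι] {e : ι → V}
    (he : LinearIndependent k e) {z w : ι → W} (h : ∑ i, z i ⊗ₜ[k] e i = ∑ i, w i ⊗ₜ[k] e i) :
    z = w := by
  refine he.tmul_left_injective ?_
  simpa using congrArg (TensorProduct.comm k W V) h

/-- A tensor in the image of `U ⊗ W`, for a subspace `U` with a finite spanning family. -/
theorem Submodule.exists_sum_tmul_of_mem_span {ι : Type*} [Fintype ι] {e : ι → V}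
    (U : Submodule k V) (he : U ≤ Submodule.span k (Set.range e)) (z : U ⊗[k] W) :
    ∃ t : ι → W, U.subtype.rTensor W z = ∑ i, e i ⊗ₜ[k] t i := by
  induction z with
  | zero => exact ⟨0, by simp⟩
  | add x y hx hy =>
    obtain ⟨s, hs⟩ := hx
    obtain ⟨t, ht⟩ := hy
    exact ⟨s + t, by simp [hs, ht, TensorProduct.tmul_add, Finset.sum_add_distrib]⟩
  | tmul u w =>
    obtain ⟨c, hc⟩ := (Submodule.mem_span_range_iff_exists_fun k).mp (he u.2)
    refine ⟨fun i => c i • w, ?_⟩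
    rw [LinearMap.rTensor_tmul, Submodule.subtype_apply, ← hc, TensorProduct.sum_tmul]
    exact Finset.sum_congr rfl fun i _ => by rw [TensorProduct.smul_tmul]

theorem Submodule.le_span_range_basis {ι : Type*} (U : Submodule k V) (b : Module.Basis ι k U) :
    U ≤ Submodule.span k (Set.range fun i => (b i : V)) := by
  intro v hv
  have h := Submodule.mem_map_of_mem (f := U.subtype) (b.mem_span ⟨v, hv⟩)
  rwa [Submodule.map_span, ← Set.range_comp] at h

/-- A basis of a finite-dimensional subspace adapted to the kernel of a linear map. -/
theorem Submodule.exists_adapted_basis (U : Submodule k V) [Module.Finite k U] (π : V →ₗ[k] W) :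
    ∃ (p q : ℕ) (e : Module.Basis (Fin p ⊕ Fin q) k U), (∀ i, π (e (.inl i)) = 0) ∧
      LinearIndependent k (fun j => π (e (.inr j))) ∧
      ∀ f ∈ U, π f = 0 → f ∈ Submodule.span k (Set.range fun i => (e (.inl i) : V)) := by
  let K : Submodule k U := LinearMap.ker (π ∘ₗ U.subtype)
  obtain ⟨K', hK'⟩ := K.exists_isCompl
  let b₁ := Module.finBasis k K
  let b₂ := Module.finBasis k K'
  let b := (b₁.prod b₂).map (K.prodEquivOfIsCompl K' hK')
  have hbl : ∀ i, b (.inl i) = b₁ i := fun i => by simp [b]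
  have hbr : ∀ i, b (.inr i) = b₂ i := fun i => by simp [b]
  refine ⟨_, _, b, fun i => ?_, ?_, fun f hf hπ => ?_⟩
  · rw [hbl]
    exact (b₁ i).2
  · simp only [hbr]
    refine b₂.linearIndependent.map' (π ∘ₗ U.subtype ∘ₗ K'.subtype) ?_
    rw [LinearMap.ker_eq_bot']
    intro m hm
    exact Subtype.ext (Submodule.disjoint_def.mp hK'.disjoint _ hm m.2)
  · have h := Submodule.mem_map_of_mem (f := U.subtype ∘ₗ K.subtype)
      (b₁.mem_span ⟨⟨f, hf⟩, hπ⟩)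
    rw [Submodule.map_span, ← Set.range_comp] at h
    simp only [hbl]
    exact h

/-- The slice of a tensor along a functional on the right factor. -/
def TensorProduct.sliceRight (φ : Module.Dual k W) : V ⊗[k] W →ₗ[k] V :=
  (TensorProduct.rid k V).toLinearMap ∘ₗ φ.lTensor V

@[simp]
theorem TensorProduct.sliceRight_tmul (φ : Module.Dual k W) (v : V) (w : W) :
    TensorProduct.sliceRight φ (v ⊗ₜ[k] w) = φ w • v := by
  simp [TensorProduct.sliceRight]

/-- Finiteness theorem for comodules: for a coassociative `Δ`, every element lies in a
finite-dimensional right coideal, spanned by slices of its comultiplication. -/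
theorem exists_finite_coideal (Δ : V →ₗ[k] V ⊗[k] V)
    (coassoc : ∀ a, TensorProduct.assoc k V V V (Δ.rTensor V (Δ a)) = Δ.lTensor V (Δ a)) (f : V) :
    ∃ U : Submodule k V, Module.Finite k U ∧
      (∀ v, v ∈ U ↔ ∃ φ : Module.Dual k V, TensorProduct.sliceRight φ (Δ f) = v) ∧
      ∀ v ∈ U, ∃ z : U ⊗[k] V, U.subtype.rTensor V z = Δ v := by
  classical
  let F : Module.Dual k V →ₗ[k] V := (TensorProduct.rid k V).toLinearMap ∘ₗ
    (LinearMap.applyₗ (Δ f)) ∘ₗ LinearMap.lTensorHom V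
  have hF : ∀ φ, F φ = TensorProduct.sliceRight φ (Δ f) := fun φ => rfl
  refine ⟨LinearMap.range F, ?_, fun v => Iff.rfl, ?_⟩
  · obtain ⟨S, hS⟩ := TensorProduct.exists_finset (Δ f)
    have hle : LinearMap.range F ≤ Submodule.span k (S.image Prod.fst : Finset V) := by
      rintro _ ⟨φ, rfl⟩
      rw [hF, hS, map_sum]
      refine Submodule.sum_mem _ fun p hp => ?_
      rw [TensorProduct.sliceRight_tmul]
      exact Submodule.smul_mem _ _ (Submodule.subset_span (by
        simpa using ⟨p.2, hp⟩))
    exact Submodule.finiteDimensional_of_le hle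
  · rintro _ ⟨φ, rfl⟩
    -- Expanding the right factor of `Δ f` in a basis makes the left coefficients slices along the
    -- coordinate functionals, so they already lie in the range of `F`.
    let b := Module.Basis.ofVectorSpace k V
    let c := TensorProduct.equivFinsuppOfBasisRight (M := V) b (Δ f)
    have hc : ∀ i, c i ∈ LinearMap.range F := fun i =>
      ⟨b.coord i, (TensorProduct.equivFinsuppOfBasisRight_apply b (Δ f) i).symm⟩
    have hsum : Δ f = c.sum fun i m => m ⊗ₜ b i := by
      rw [← TensorProduct.equivFinsuppOfBasisRight_symm_apply, LinearEquiv.symm_apply_apply]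
    -- Slicing the last factor commutes with applying `Δ` to the first. Coassociativity then moves
    -- `Δ` to the right factor and leaves the coefficients `c i` untouched.
    have key : ∀ w : V ⊗[k] V, (TensorProduct.sliceRight φ).lTensor V
        (TensorProduct.assoc k V V V (Δ.rTensor V w)) = Δ (TensorProduct.sliceRight φ w) := by
      intro w
      induction w with
      | zero => simp
      | add x y hx hy => simp only [map_add, hx, hy]
      | tmul x y =>
        simp only [LinearMap.rTensor_tmul, TensorProduct.sliceRight_tmul, map_smul]
        induction Δ x with
        | zero => simp
        | add x y hx hy => simp only [TensorProduct.add_tmul, map_add, hx, hy, smul_add]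
        | tmul p q => simp [TensorProduct.tmul_smul]
    refine ⟨c.sum fun i _ => (⟨c i, hc i⟩ : LinearMap.range F) ⊗ₜ
      TensorProduct.sliceRight φ (Δ (b i)), ?_⟩
    rw [hF, ← key, coassoc, hsum]
    simp [Finsupp.sum]

end LinearAlgebra

/-! ### Points of commutative Hopf algebras and matrix coefficients -/

namespace HopfAlgebra

open WithConv Coalgebra

section Points

variable {k A R S T : Type*} [CommRing k] [CommRing A] [HopfAlgebra k A] [CommRing R] [Algebra k R]
  [CommRing S] [Algebra k S] [CommRing T] [Algebra k T]

/-- The group of `R`-points of the affine group scheme of a commutative Hopf algebra. -/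
abbrev Point (k A R : Type*) [CommRing k] [CommRing A] [HopfAlgebra k A] [CommRing R]
    [Algebra k R] := WithConv (A →ₐ[k] R)

namespace Point

/-- Functoriality of the group of points. -/
def map (φ : R →ₐ[k] S) : Point k A R →* Point k A S where
  toFun g := toConv (φ.comp g.ofConv)
  map_one' := by
    ext a
    simp
  map_mul' g h := WithConv.ext (AlgHom.comp_convMul_distrib φ g h)

@[simp]
theorem map_apply (φ : R →ₐ[k] S) (g : Point k A R) (a : A) : map φ g a = φ (g a) := rfl

theorem mul_apply_of_comul_eq {ι : Type*} [Fintype ι] {a : A} {x y : ι → A}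
    (h : comul (R := k) a = ∑ i, x i ⊗ₜ y i) (g g' : Point k A R) :
    (g * g') a = ∑ i, g (x i) * g' (y i) := by
  rw [AlgHom.convMul_apply, h, map_sum]
  simp

/-- The antipode gives inverses of points. -/
noncomputable instance : Group (Point k A R) where
  inv g := toConv (g.ofConv.comp (HopfAlgebra.antipodeAlgHom k A))
  inv_mul_cancel g := by
    ext a
    have h := sum_antipode_mul_eq_algebraMap_counit (ℛ k a)
    have h' := congrArg g.ofConv h
    rw [AlgHom.convMul_apply, ← (ℛ k a).eq]
    simpa using h'

theorem inv_apply (g : Point k A R) (a : A) : g⁻¹ a = g (antipode k a) := rfl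

end Point

end Points

section Coefficients

variable {k A : Type*} [Field k] [CommRing A] [HopfAlgebra k A] {ι : Type*} [Fintype ι]

/-- Compare the coefficients of the independent `e i` on the two sides of coassociativity. Thus `t`
evaluates at points to a matrix multiplicative in the point; the counit axiom gives its value at the
identity in the same way. -/
theorem comul_coeff_right {e : ι → A} {t : ι → ι → A} (he : LinearIndependent k e)
    (h : ∀ j, comul (R := k) (e j) = ∑ i, e i ⊗ₜ t i j) (i j : ι) :
    comul (R := k) (t i j) = ∑ l, t i l ⊗ₜ t l j := by
  have hc := coassoc_apply (R := k) (e j)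
  simp only [h, map_sum, LinearMap.rTensor_tmul, LinearMap.lTensor_tmul, TensorProduct.sum_tmul,
    TensorProduct.assoc_tmul] at hc
  rw [Finset.sum_comm] at hc
  simp only [← TensorProduct.tmul_sum] at hc
  exact (congrFun (he.tmul_left_injective hc) i).symm

theorem counit_coeff_right [DecidableEq ι] {e : ι → A} {t : ι → ι → A} (he : LinearIndependent k e)
    (h : ∀ j, comul (R := k) (e j) = ∑ i, e i ⊗ₜ t i j) (i j : ι) :
    counit (R := k) (t i j) = if i = j then 1 else 0 := by
  have hc := lTensor_counit_comul (R := k) (e j)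
  simp only [h, map_sum, LinearMap.lTensor_tmul] at hc
  have hj : e j ⊗ₜ[k] (1 : k) = ∑ i, e i ⊗ₜ[k] (if i = j then (1 : k) else 0) := by
    rw [Finset.sum_eq_single j] <;> simp +contextual
  exact congrFun (he.tmul_left_injective (hc.trans hj)) i

theorem comul_coeff_left {e : ι → A} {s : ι → ι → A} (he : LinearIndependent k e)
    (h : ∀ i, comul (R := k) (e i) = ∑ j, s i j ⊗ₜ e j) (i j : ι) :
    comul (R := k) (s i j) = ∑ l, s i l ⊗ₜ s l j := by
  have hc := coassoc_symm_apply (R := k) (e i)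
  simp only [h, map_sum, LinearMap.rTensor_tmul, LinearMap.lTensor_tmul, TensorProduct.tmul_sum,
    TensorProduct.assoc_symm_tmul] at hc
  rw [Finset.sum_comm] at hc
  simp only [← TensorProduct.sum_tmul] at hc
  exact (congrFun (he.tmul_right_injective hc) j).symm

theorem counit_coeff_left [DecidableEq ι] {e : ι → A} {s : ι → ι → A} (he : LinearIndependent k e)
    (h : ∀ i, comul (R := k) (e i) = ∑ j, s i j ⊗ₜ e j) (i j : ι) :
    counit (R := k) (s i j) = if j = i then 1 else 0 := by
  have hc := rTensor_counit_comul (R := k) (e i)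
  simp only [h, map_sum, LinearMap.rTensor_tmul] at hc
  have hi : (1 : k) ⊗ₜ[k] e i = ∑ j, (if j = i then (1 : k) else 0) ⊗ₜ[k] e j := by
    rw [Finset.sum_eq_single i] <;> simp +contextual
  exact congrFun (he.tmul_right_injective (hc.trans hi)) j

end Coefficients

/-! ### Coideals adapted to an ideal, and semi-invariants -/

variable {k A : Type u} [Field k] [CommRing A] [HopfAlgebra k A]

/-- Every element of an ideal `I` lies in a finite-dimensional right coideal; its basis is chosen
adapted to `I`. -/
theorem exists_adapted_coideal (I : Ideal A) {f : A} (hf : f ∈ I) :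
    ∃ (p q : ℕ) (e : Fin p ⊕ Fin q → A) (t : Fin p ⊕ Fin q → Fin p ⊕ Fin q → A),
      LinearIndependent k e ∧ (∀ i, e (.inl i) ∈ I) ∧
      LinearIndependent k (fun j => Ideal.Quotient.mkₐ k I (e (.inr j))) ∧
      f ∈ Submodule.span k (Set.range fun i => e (.inl i)) ∧
      ∀ j, comul (R := k) (e j) = ∑ i, e i ⊗ₜ t i j := by
  obtain ⟨V, hfin, hV, hΔ⟩ := exists_finite_coideal (comul (R := k) (A := A)) coassoc_apply f
  have hfV : f ∈ V := (hV f).mpr ⟨counit, by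
    simp [TensorProduct.sliceRight, lTensor_counit_comul]⟩
  obtain ⟨p, q, b, hl, hr, hspan⟩ := V.exists_adapted_basis (Ideal.Quotient.mkₐ k I).toLinearMap
  have ht : ∀ j, ∃ t : Fin p ⊕ Fin q → A, comul (R := k) (b j : A) = ∑ i, (b i : A) ⊗ₜ t i := by
    intro j
    obtain ⟨z, hz⟩ := hΔ (b j) (b j).2
    obtain ⟨t, ht⟩ := V.exists_sum_tmul_of_mem_span (V.le_span_range_basis b) z
    exact ⟨t, hz.symm.trans ht⟩
  choose t ht using ht
  exact ⟨p, q, fun i => (b i : A), fun i j => t j i,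
    b.linearIndependent.map' V.subtype (Submodule.ker_subtype V),
    fun i => Ideal.Quotient.eq_zero_iff_mem.mp (hl i), hr,
    hspan f hfV (Ideal.Quotient.eq_zero_iff_mem.mpr hf), ht⟩

/-- The ideal `I` defines a normal subgroup functor of the functor of points. -/
def IsNormalIdeal (k : Type u) {A : Type u} [Field k] [CommRing A] [HopfAlgebra k A]
    (I : Ideal A) : Prop :=
  ∀ (R : Type u) [CommRing R] [Algebra k R],
    ∃ N : Subgroup (Point k A R), N.Normal ∧ ∀ n, n ∈ N ↔ ∀ a ∈ I, n a = 0

/-- The functions `a` with `a(gn) = a(g) f(n)` for all points `g` and all points `n` of the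
subgroup defined by `I`. -/
def semiInvariants (k : Type u) {A : Type u} [Field k] [CommRing A] [HopfAlgebra k A]
    (I : Ideal A) (f : A) : Submodule k A where
  carrier := {a | ∀ (R : Type u) [CommRing R] [Algebra k R] (g n : Point k A R),
    (∀ i ∈ I, n i = 0) → (g * n) a = g a * n f}
  zero_mem' R _ _ g n hn := by simp
  add_mem' {a b} ha hb R _ _ g n hn := by
    rw [map_add, map_add, ha R g n hn, hb R g n hn, add_mul]
  smul_mem' c a ha R _ _ g n hn := by
    rw [map_smul, map_smul, ha R g n hn, smul_mul_assoc]

/-- Slices are left translates by the generic point, contracted with `φ`. Identities that hold for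
all left translates therefore pass to slices. -/
theorem slice_mul_apply {R : Type*} [CommRing R] [Algebra k R] (φ : Module.Dual k A)
    (h : Point k A R) (a : A) :
    TensorProduct.lid k R (φ.rTensor R
      ((toConv Algebra.TensorProduct.includeLeft *
        Point.map (Algebra.TensorProduct.includeRight : R →ₐ[k] A ⊗[k] R) h : Point k A _) a)) =
      h (TensorProduct.sliceRight φ (TensorProduct.comm k A A (comul a))) := by
  rw [AlgHom.convMul_apply]
  generalize comul (R := k) a = w
  induction w with
  | zero => simp
  | add x y hx hy => simp only [map_add, hx, hy]
  | tmul x y => simp [Point.map]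

/-- Left translation by the generic point commutes with right translation by `n`, and contraction
with `φ` is `R`-linear, so the factor `n f` comes out unchanged. -/
theorem slice_mem_semiInvariants {I : Ideal A} {f a : A} (ha : a ∈ semiInvariants k I f)
    (φ : Module.Dual k A) :
    TensorProduct.sliceRight φ (TensorProduct.comm k A A (comul a)) ∈ semiInvariants k I f := by
  intro R _ _ g n hn
  let ι : R →ₐ[k] A ⊗[k] R := Algebra.TensorProduct.includeRight
  let x : Point k A (A ⊗[k] R) := toConv Algebra.TensorProduct.includeLeft
  have h := ha _ (x * Point.map ι g) (Point.map ι n) (fun i hi => by simp [hn i hi])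
  rw [mul_assoc, ← map_mul] at h
  rw [← slice_mul_apply, h, ← slice_mul_apply φ g]
  generalize (x * Point.map ι g) a = w
  induction w with
  | zero => simp
  | add x y hx hy => simp only [map_add, add_mul, hx, hy]
  | tmul x y => simp [ι]

/-- The finiteness theorem applied to the opposite comultiplication. The resulting space consists of
slices of `f`, so all of it has the weight of `f`. -/
theorem exists_left_coideal {I : Ideal A} {f : A} (hf : f ∈ semiInvariants k I f) :
    ∃ (r : ℕ) (e : Fin r → A) (s : Fin r → Fin r → A), LinearIndependent k e ∧
      f ∈ Submodule.span k (Set.range e) ∧ (∀ i, e i ∈ semiInvariants k I f) ∧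
      ∀ i, comul (R := k) (e i) = ∑ j, s i j ⊗ₜ e j := by
  let Δ : A →ₗ[k] A ⊗[k] A := (TensorProduct.comm k A A).toLinearMap ∘ₗ comul
  have hΔ' : ∀ a, TensorProduct.assoc k A A A (Δ.rTensor A (Δ a)) = Δ.lTensor A (Δ a) := by
    intro a
    -- `τ` reverses the order of the three factors and so turns coassociativity of `comul` into that
    -- of `Δ`.
    let τ : (A ⊗[k] A) ⊗[k] A →ₗ[k] A ⊗[k] (A ⊗[k] A) :=
      (TensorProduct.comm k A A).toLinearMap.lTensor A ∘ₗ
        (TensorProduct.comm k (A ⊗[k] A) A).toLinearMap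
    have h₁ : ∀ w : A ⊗[k] A, TensorProduct.assoc k A A A (Δ.rTensor A
        (TensorProduct.comm k A A w)) =
        τ ((TensorProduct.assoc k A A A).symm (comul.lTensor A w)) := by
      intro w
      induction w with
      | zero => simp
      | add x y hx hy => simp only [map_add, hx, hy]
      | tmul x y =>
        simp only [TensorProduct.comm_tmul, LinearMap.rTensor_tmul, LinearMap.lTensor_tmul, Δ,
          LinearMap.comp_apply]
        induction comul (R := k) y with
        | zero => simp
        | add x y hx hy => simp only [map_add, TensorProduct.add_tmul, TensorProduct.tmul_add,
            hx, hy]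
        | tmul p q => simp [τ]
    have h₂ : ∀ w : A ⊗[k] A, Δ.lTensor A (TensorProduct.comm k A A w) =
        τ (comul.rTensor A w) := by
      intro w
      induction w with
      | zero => simp
      | add x y hx hy => simp only [map_add, hx, hy]
      | tmul x y => simp [τ, Δ]
    change TensorProduct.assoc k A A A (Δ.rTensor A (TensorProduct.comm k A A (comul a))) =
      Δ.lTensor A (TensorProduct.comm k A A (comul a))
    rw [h₁, h₂, coassoc_symm_apply]
  obtain ⟨V, hfin, hV, hΔ⟩ := exists_finite_coideal Δ hΔ' f
  have hfV : f ∈ V := (hV f).mpr ⟨counit, by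
    have : ∀ w : A ⊗[k] A, TensorProduct.sliceRight counit (TensorProduct.comm k A A w) =
        TensorProduct.lid k A (counit.rTensor A w) := fun w => by
      induction w with
      | zero => simp
      | add x y hx hy => simp only [map_add, hx, hy]
      | tmul x y => simp
    simp [Δ, this, rTensor_counit_comul]⟩
  let b := Module.finBasis k V
  have ht : ∀ j, ∃ t : Fin _ → A, comul (R := k) (b j : A) = ∑ i, t i ⊗ₜ (b i : A) := by
    intro j
    obtain ⟨z, hz⟩ := hΔ (b j) (b j).2
    obtain ⟨t, ht⟩ := V.exists_sum_tmul_of_mem_span (V.le_span_range_basis b) z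
    refine ⟨t, (TensorProduct.comm k A A).injective ?_⟩
    rw [map_sum]
    exact hz.symm.trans ht
  choose t ht using ht
  refine ⟨_, fun i => (b i : A), t, ?_, V.le_span_range_basis b hfV, fun i => ?_, ht⟩
  · exact b.linearIndependent.map' V.subtype (Submodule.ker_subtype V)
  · obtain ⟨φ, hφ⟩ := (hV _).mp (b i).2
    change (b i : A) ∈ _
    rw [← hφ]
    exact slice_mem_semiInvariants hf φ

end HopfAlgebra

/-! ### A function of inverse weight -/

namespace HopfAlgebra

open WithConv Coalgebra

variable {k A : Type u} [Field k] [CommRing A] [HopfAlgebra k A]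

/-- Linearly independent functions have nonzero determinant on sufficiently generic points. -/
theorem exists_points_det_ne_zero {r : ℕ} {a : Fin r → A} (ha : LinearIndependent k a) :
    ∃ (R : Type u) (_ : CommRing R) (_ : Algebra k R) (g : Fin r → Point k A R),
      (Matrix.of fun i j => g j (a i)).det ≠ 0 := by
  induction r with
  | zero => exact ⟨k, inferInstance, inferInstance, finZeroElim, by simp⟩
  | succ r ih =>
    obtain ⟨R, _, _, g, hg⟩ := ih (ha.comp Fin.succ (Fin.succ_injective r))
    -- The new first column is the generic point. Expanding along it gives the sum of ± `a i ⊗ M i`;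
    -- if this vanishes, independence forces `M 0 = 0`, against the induction hypothesis.
    let ι : R →ₐ[k] A ⊗[k] R := Algebra.TensorProduct.includeRight
    refine ⟨A ⊗[k] R, inferInstance, inferInstance,
      Fin.cons (toConv Algebra.TensorProduct.includeLeft) fun j => Point.map ι (g j), fun h => ?_⟩
    let M : Fin (r + 1) → R := fun i =>
      (Matrix.of fun (i' j : Fin r) => g j (a (i.succAbove i'))).det
    have hM : ∀ i, ((Matrix.of fun (i j : Fin (r + 1)) => (Fin.cons (toConv
        Algebra.TensorProduct.includeLeft) (fun j => Point.map ι (g j)) :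
          Fin (r + 1) → Point k A (A ⊗[k] R)) j (a i)).submatrix i.succAbove Fin.succ).det =
          1 ⊗ₜ M i := by
      intro i
      change _ = ι (M i)
      rw [AlgHom.map_det]
      rfl
    rw [Matrix.det_succ_column_zero] at h
    simp only [hM] at h
    have h' : ∑ i, a i ⊗ₜ[k] ((-1) ^ (i : ℕ) * M i) = ∑ i, a i ⊗ₜ[k] (0 : R) := by
      rw [← Finset.sum_congr rfl fun i _ => ?_, h]
      · simp
      · have : (a i ⊗ₜ[k] ((-1) ^ (i : ℕ) * M i) : A ⊗[k] R) =
          (1 ⊗ₜ ((-1) ^ (i : ℕ))) * (a i ⊗ₜ 1) * (1 ⊗ₜ M i) := by simp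
        rw [this]
        have h1 : ((1 : A) ⊗ₜ[k] ((-1 : R) ^ (i : ℕ))) = (-1) ^ (i : ℕ) := by
          change ι _ = _
          simp
        rw [h1]
        rfl
    have h0 := congrFun (ha.tmul_left_injective h') 0
    apply hg
    simpa [M] using h0

namespace SemiInvariant

variable {R S : Type*} [CommRing R] [Algebra k R] [CommRing S] [Algebra k S]

/-- The function `x ↦ δ(x)⁻¹ ∏_{j ≠ j₀} f(k_j x k_j⁻¹) det (a_i(g_j))` with
`k_j = g_j⁻¹ g_{j₀}`. -/
noncomputable def twist {r : ℕ} (f δ : A) (a : Fin r → A) (j₀ : Fin r) (g : Fin r → Point k A R)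
    (x : Point k A R) : R :=
  x⁻¹ δ * (∏ j ∈ Finset.univ.erase j₀, ((g j)⁻¹ * g j₀ * x * ((g j)⁻¹ * g j₀)⁻¹) f) *
    (Matrix.of fun i j => g j (a i)).det

theorem map_twist {r : ℕ} (f δ : A) (a : Fin r → A) (j₀ : Fin r) (g : Fin r → Point k A R)
    (x : Point k A R) (φ : R →ₐ[k] S) :
    φ (twist f δ a j₀ g x) = twist f δ a j₀ (fun j => Point.map φ (g j)) (Point.map φ x) := by
  simp only [twist, map_mul, map_prod, AlgHom.map_det]
  simp only [← Point.map_apply, map_mul, map_inv]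
  rfl

variable {I : Ideal A} {f : A} {r : ℕ} {a : Fin r → A} {s : Fin r → Fin r → A}

theorem det_mul_apply (hs : ∀ i j, comul (R := k) (s i j) = ∑ l, s i l ⊗ₜ s l j)
    (g h : Point k A R) :
    (g * h) (Matrix.of s).det = g (Matrix.of s).det * h (Matrix.of s).det := by
  simp only [AlgHom.map_det, ← Matrix.det_mul]
  congr 1
  ext i j
  exact Point.mul_apply_of_comul_eq (hs i j) g h

theorem one_apply_det
    (hs : ∀ i j, counit (R := k) (s i j) = if j = i then 1 else 0) :
    (1 : Point k A R) (Matrix.of s).det = 1 := by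
  rw [AlgHom.map_det, ← Matrix.det_one (n := Fin r)]
  congr 1
  ext i j
  change (1 : Point k A R) (s i j) = _
  rw [AlgHom.convOne_apply, hs, Matrix.one_apply]
  by_cases h : i = j <;> simp [h, eq_comm]

end SemiInvariant

open SemiInvariant

/-- If `f` is multiplicative along the normal subgroup defined by `I`, there is a function whose
weight is inverse to that of `f`. -/
theorem exists_inverse_weight {I : Ideal A} (hI : IsNormalIdeal k I) {f : A}
    (hf : f ∈ semiInvariants k I f) (hf1 : counit (R := k) f = 1) :
    ∃ h : A, counit (R := k) h = 1 ∧
      ∀ (R : Type u) [CommRing R] [Algebra k R] (g n : Point k A R), (∀ i ∈ I, n i = 0) →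
        (g * n) h * n f = g h := by
  obtain ⟨r, a, s, ha, hfa, haf, has⟩ := exists_left_coideal hf
  have hs := comul_coeff_left ha has
  have hs1 := counit_coeff_left ha has
  have : Nonempty (Fin r) := by
    by_contra hr
    rw [not_nonempty_iff] at hr
    simp only [Set.range_eq_empty, Submodule.span_empty, Submodule.mem_bot] at hfa
    simp [hfa] at hf1
  obtain ⟨j₀⟩ := this
  set δ := (Matrix.of s).det with hδ
  obtain ⟨R, _, _, g, hg⟩ := exists_points_det_ne_zero ha
  have key : ∀ (T : Type u) [CommRing T] [Algebra k T] (g : Fin r → Point k A T)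
      (x n : Point k A T), (∀ i ∈ I, n i = 0) →
      twist f δ a j₀ g (x * n) * n f = twist f δ a j₀ g x := by
    intro T _ _ g x n hn
    obtain ⟨N, hN, hNI⟩ := hI T
    have hnN : n ∈ N := (hNI n).mpr hn
    set D := (Matrix.of fun i j => g j (a i)).det with hD
    -- The matrix of values `a_i(y g_j)` is computed twice. Left translation by `y` multiplies its
    -- determinant by `δ(y) = δ(n)`. Writing `y g_j = g_j (c_j n c_j⁻¹)`, semi-invariance multiplies
    -- column `j` by `f(c_j n c_j⁻¹)`, and for `j = j₀` this factor is `f(n)`. So, up to the factor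
    -- `D`, the inverse of `f(n)` is `δ(n)⁻¹` times the remaining factors, which is what `twist`
    -- imitates.
    let y := g j₀ * n * (g j₀)⁻¹
    have hyδ : y δ = n δ := by
      have h1 : g j₀ δ * (g j₀)⁻¹ δ = 1 := by
        rw [← det_mul_apply hs, mul_inv_cancel, one_apply_det hs1]
      simp only [y, hδ, det_mul_apply hs] at h1 ⊢
      linear_combination (n (Matrix.of s).det) * h1
    let c : Fin r → Point k A T := fun j => (g j)⁻¹ * g j₀
    have hconj : ∀ j, ∀ i ∈ I, (c j * n * (c j)⁻¹) i = 0 := fun j =>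
      (hNI _).mp (hN.conj_mem n hnN (c j))
    have h1 : (Matrix.of fun i j => (y * g j) (a i)).det = y δ * D := by
      rw [hδ, AlgHom.map_det, hD, ← Matrix.det_mul]
      congr 1
      ext i j
      exact Point.mul_apply_of_comul_eq (has i) y (g j)
    have h2 : (Matrix.of fun i j => (y * g j) (a i)).det =
        (∏ j, (c j * n * (c j)⁻¹) f) * D := by
      rw [hD, ← Matrix.det_mul_row]
      congr 1
      ext i j
      have : y * g j = g j * (c j * n * (c j)⁻¹) := by
        simp only [y, c]
        group
      change (y * g j) (a i) = _ * (g j) (a i)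
      rw [this, haf i T _ _ (hconj j), mul_comm]
    rw [← Finset.mul_prod_erase _ _ (Finset.mem_univ j₀)] at h2
    have hc0 : c j₀ = 1 := inv_mul_cancel _
    rw [hc0, one_mul, inv_one, mul_one] at h2
    have h3 : (x * n)⁻¹ δ = n⁻¹ δ * x⁻¹ δ := by rw [mul_inv_rev, hδ, det_mul_apply hs]
    have h4 : n⁻¹ δ * n δ = 1 := by
      rw [hδ, ← det_mul_apply hs, inv_mul_cancel, one_apply_det hs1]
    have h5 : ∀ j, (c j * (x * n) * (c j)⁻¹) f =
        (c j * x * (c j)⁻¹) f * (c j * n * (c j)⁻¹) f := by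
      intro j
      rw [← hf T _ _ (hconj j)]
      congr 1
      group
    change (x * n)⁻¹ δ * (∏ j ∈ Finset.univ.erase j₀, (c j * (x * n) * (c j)⁻¹) f) * D * n f =
      x⁻¹ δ * (∏ j ∈ Finset.univ.erase j₀, (c j * x * (c j)⁻¹) f) * D
    rw [h3, Finset.prod_congr rfl fun j _ => h5 j, Finset.prod_mul_distrib]
    have h6 := h2.symm.trans (h1.trans (by rw [hyδ]))
    linear_combination (n⁻¹ δ * x⁻¹ δ *
      ∏ j ∈ Finset.univ.erase j₀, (c j * x * (c j)⁻¹) f) * h6 +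
      (x⁻¹ δ * (∏ j ∈ Finset.univ.erase j₀, (c j * x * (c j)⁻¹) f) * D) * h4
  -- The determinant is nonzero but need not be a unit. Instead of dividing by it, a functional
  -- normalizes it to 1 and at the same time brings `twist`, whose coefficients lie in `R`, back to
  -- a function in `A`.
  obtain ⟨φ, hφ⟩ : ∃ φ : Module.Dual k R, φ (Matrix.of fun i j => g j (a i)).det = 1 := by
    obtain ⟨φ, hφ⟩ := Module.exists_dual_forall_apply_eq_one (K := k) (s := (Set.univ : Set Unit))
      (v := fun _ => (Matrix.of fun i j => g j (a i)).det) (by simpa using hg)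
    exact ⟨φ, hφ () trivial⟩
  let gen : A ⊗[k] R := twist f δ a j₀
    (fun j => Point.map Algebra.TensorProduct.includeRight (g j))
    (toConv Algebra.TensorProduct.includeLeft)
  have slice : ∀ (T : Type u) [CommRing T] [Algebra k T] (x : Point k A T),
      x (TensorProduct.sliceRight φ gen) = TensorProduct.sliceRight φ (twist f δ a j₀
        (fun j => Point.map Algebra.TensorProduct.includeRight (g j))
        (Point.map (Algebra.TensorProduct.includeLeft : T →ₐ[k] T ⊗[k] R) x)) := by
    intro T _ _ x
    let Φ : A ⊗[k] R →ₐ[k] T ⊗[k] R := Algebra.TensorProduct.map x.ofConv (AlgHom.id k R)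
    have h1 : Φ gen = twist f δ a j₀
        (fun j => Point.map Algebra.TensorProduct.includeRight (g j))
        (Point.map (Algebra.TensorProduct.includeLeft : T →ₐ[k] T ⊗[k] R) x) := by
      rw [map_twist]
      congr 1
      funext j
      ext b
      simp [Φ]
    rw [← h1]
    generalize gen = w
    induction w with
    | zero => simp
    | add x y hx hy => simp only [map_add, hx, hy]
    | tmul p q => simp [Φ]
  refine ⟨TensorProduct.sliceRight φ gen, ?_, fun T _ _ x n hn => ?_⟩
  · have h := slice k 1
    rw [AlgHom.convOne_apply] at h
    rw [Algebra.algebraMap_self_apply] at h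
    rw [h, map_one, twist]
    simp only [mul_one, inv_one, mul_inv_cancel, AlgHom.convOne_apply, hf1, map_one,
      Finset.prod_const_one, one_mul, one_apply_det hs1, hδ]
    change TensorProduct.sliceRight φ (Matrix.det ((Algebra.TensorProduct.includeRight :
      R →ₐ[k] k ⊗[k] R).mapMatrix (Matrix.of fun i j => g j (a i)))) = 1
    rw [← AlgHom.map_det]
    simp [hφ]
  · have hk := key (T ⊗[k] R) (fun j => Point.map Algebra.TensorProduct.includeRight (g j))
      (Point.map (Algebra.TensorProduct.includeLeft : T →ₐ[k] T ⊗[k] R) x)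
      (Point.map (Algebra.TensorProduct.includeLeft : T →ₐ[k] T ⊗[k] R) n)
      (fun i hi => by rw [Point.map_apply, hn i hi, map_zero])
    rw [slice, slice, map_mul, ← hk]
    generalize twist (k := k) (R := T ⊗[k] R) f δ a j₀ _ (_ * _) = w
    induction w with
    | zero => simp
    | add x y hx hy => simp only [map_add, hx, hy, add_mul]
    | tmul p q => simp
end HopfAlgebra

/-! ### The ideal of a normal subgroup is generated by invariants -/

namespace HopfAlgebra

open WithConv Coalgebra

variable {k A : Type u} [Field k] [CommRing A] [HopfAlgebra k A]

/-- The subalgebra of functions that are invariant under right translation by the points of the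
subgroup defined by `I`. -/
def invariants (k : Type u) {A : Type u} [Field k] [CommRing A] [HopfAlgebra k A]
    (I : Ideal A) : Subalgebra k A where
  carrier := {a | ∀ (R : Type u) [CommRing R] [Algebra k R] (g n : Point k A R),
    (∀ i ∈ I, n i = 0) → (g * n) a = g a}
  add_mem' {a b} ha hb R _ _ g n hn := by rw [map_add, map_add, ha R g n hn, hb R g n hn]
  mul_mem' {a b} ha hb R _ _ g n hn := by rw [map_mul, map_mul, ha R g n hn, hb R g n hn]
  algebraMap_mem' c R _ _ g n hn := by rw [AlgHom.commutes, AlgHom.commutes]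

/-- Cramer's rule: up to the unit `M.det`, these determinants are the coordinates of `v` with
respect to the rows of `M`. -/
theorem matrix_row_eq_zero {R : Type*} [CommRing R] {p : ℕ} (M : Matrix (Fin p) (Fin p) R)
    (hM : IsUnit M.det) (v : Fin p → R) (h : ∀ i, (M.updateRow i v).det = 0) : v = 0 := by
  have h1 := Matrix.mulVec_cramer M.transpose v
  have h2 : M.transpose.cramer v = 0 := by
    funext i
    rw [Matrix.cramer_transpose_apply, h, Pi.zero_apply]
  rw [h2, Matrix.mulVec_zero, Matrix.det_transpose] at h1
  exact (hM.smul_eq_zero).mp h1.symm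

/-- A normal subgroup of an affine group scheme is cut out by the invariant functions: the
defining ideal is generated by the invariant functions vanishing at the identity. -/
theorem le_span_invariants {I : Ideal A} (hI : IsNormalIdeal k I) :
    I ≤ Ideal.span {b | b ∈ invariants k I ∧ counit (R := k) b = 0} := by
  intro f hf
  obtain ⟨p, q, e, t, he, heI, hind, hfe, ht⟩ := exists_adapted_coideal (k := k) I hf
  have hcomul := comul_coeff_right he ht
  have hcounit := counit_coeff_right he ht
  have hI0 : ∀ i ∈ I, counit (R := k) i = 0 := by
    obtain ⟨N, -, hN⟩ := hI k
    exact fun i hi => (hN 1).mp N.one_mem i hi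
  -- The subgroup stabilizes the span of the `e (.inl i)`. For the generic pair `m`, `n` of its
  -- points, `e (.inl j)` vanishes at `m * n`; independence of the `e (.inr l)` modulo `I` separates
  -- the terms.
  have hblock : ∀ l j, t (.inr l) (.inl j) ∈ I := by
    intro l j
    let π := Ideal.Quotient.mkₐ k I
    let m : Point k A ((A ⧸ I) ⊗[k] (A ⧸ I)) :=
      toConv (Algebra.TensorProduct.includeLeft.comp π)
    let n : Point k A ((A ⧸ I) ⊗[k] (A ⧸ I)) :=
      toConv (Algebra.TensorProduct.includeRight.comp π)
    obtain ⟨N, -, hN⟩ := hI ((A ⧸ I) ⊗[k] (A ⧸ I))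
    have hπ : ∀ i ∈ I, π i = 0 := fun i hi => Ideal.Quotient.eq_zero_iff_mem.mpr hi
    have hm : m ∈ N := (hN m).mpr fun i hi => by simp [m, hπ i hi]
    have hn : n ∈ N := (hN n).mpr fun i hi => by simp [n, hπ i hi]
    have h := (hN _).mp (N.mul_mem hm hn) _ (heI j)
    rw [Point.mul_apply_of_comul_eq (ht (.inl j)), Fintype.sum_sum_type] at h
    have h0 : ∀ i, m (e (.inl i)) = 0 := fun i => (hN m).mp hm _ (heI i)
    have h' : ∑ l, π (e (.inr l)) ⊗ₜ[k] π (t (.inr l) (.inl j)) =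
        ∑ l, π (e (.inr l)) ⊗ₜ[k] 0 := by
      simpa [h0, m, n] using h
    exact Ideal.Quotient.eq_zero_iff_mem.mp (congrFun (hind.tmul_left_injective h') l)
  -- `S` selects the rows, while the columns are always those of the `inl` block. By `hblock`, right
  -- translation by a point of the subgroup multiplies each selected matrix by the same `p × p`
  -- block, whose determinant is `f₀`.
  let minor : (Fin p → Fin p ⊕ Fin q) → A := fun S =>
    (Matrix.of fun i j => t (S i) (.inl j)).det
  let f₀ := minor Sum.inl
  have hminor : ∀ S, minor S ∈ semiInvariants k I f₀ := by
    intro S R _ _ g n hn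
    simp only [minor, f₀, AlgHom.map_det, ← Matrix.det_mul]
    congr 1
    ext i j
    change (g * n) (t (S i) (.inl j)) = ∑ l, g (t (S i) (.inl l)) * n (t (.inl l) (.inl j))
    rw [Point.mul_apply_of_comul_eq (hcomul _ _), Fintype.sum_sum_type]
    simp [hn _ (hblock _ _)]
  have hcminor : ∀ S, counit (R := k) (minor S) =
      (Matrix.of fun i j => if S i = .inl j then (1 : k) else 0).det := by
    intro S
    change Bialgebra.counitAlgHom k A _ = _
    rw [AlgHom.map_det]
    congr 1
    ext i j
    exact hcounit _ _
  have hf₀ : counit (R := k) f₀ = 1 := by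
    rw [hcminor, ← Matrix.det_one (n := Fin p)]
    congr 1
    ext i j
    simp [Matrix.one_apply]
  obtain ⟨h, hh1, hh⟩ := exists_inverse_weight hI (hminor Sum.inl) hf₀
  set J := Ideal.span {b | b ∈ invariants k I ∧ counit (R := k) b = 0} with hJ
  let π := Ideal.Quotient.mkₐ k J
  -- Modulo `J` every invariant becomes the constant given by its value at the identity.
  have hπB : ∀ b ∈ invariants k I, π b = algebraMap k _ (counit (R := k) b) := by
    intro b hb
    have : b - algebraMap k A (counit (R := k) b) ∈ J := Ideal.subset_span
      ⟨sub_mem hb (Subalgebra.algebraMap_mem _ _), by simp⟩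
    rw [← AlgHom.commutes π]
    exact Ideal.Quotient.eq.mpr this
  have hπ : ∀ S, π (minor S) * π h = algebraMap k _ (counit (R := k) (minor S)) := by
    intro S
    rw [← map_mul, hπB _ ?_, Bialgebra.counit_mul, hh1, mul_one]
    intro R _ _ g n hn
    rw [map_mul, map_mul, hminor S R g n hn, ← hh R g n hn]
    ring
  have hunit : π f₀ * π h = 1 := by rw [hπ, hf₀, map_one]
  have hzero : ∀ S, counit (R := k) (minor S) = 0 → π (minor S) = 0 := by
    intro S hS
    have h1 := hπ S
    rw [hS, map_zero] at h1
    linear_combination (π f₀) * h1 - π (minor S) * hunit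
  have hrow : ∀ l, (fun j => π (t (.inr l) (.inl j))) = 0 := by
    intro l
    refine matrix_row_eq_zero (Matrix.of fun i j => π (t (.inl i) (.inl j))) ?_ _ fun i => ?_
    · refine IsUnit.of_mul_eq_one (π h) ?_
      rw [← hunit, AlgHom.map_det]
      rfl
    -- Replacing row `i` by a row of the lower block gives a minor that vanishes at the identity,
    -- where `t` is the identity matrix.
    · have h1 := hzero (Function.update Sum.inl i (.inr l)) ?_
      · rw [← h1, AlgHom.map_det]
        congr 1
        ext i' j
        by_cases hi : i' = i
        · subst hi
          simp
        · simp [hi]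
      · rw [hcminor]
        refine Matrix.det_eq_zero_of_row_eq_zero i fun j => ?_
        simp
  have heJ : ∀ j, e (.inl j) ∈ J := by
    intro j
    -- In this expansion the `inl` terms vanish because the counit kills `I`, and the `inr` terms
    -- vanish modulo `J` by `hrow`.
    have h1 : e (.inl j) = ∑ i, counit (R := k) (e i) • t i (.inl j) := by
      have h2 := rTensor_counit_comul (R := k) (e (.inl j))
      rw [ht] at h2
      simpa using (congrArg (TensorProduct.lid k A) h2).symm
    refine Ideal.Quotient.eq_zero_iff_mem.mp ?_
    change π _ = 0
    rw [h1, map_sum, Fintype.sum_sum_type]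
    have h3 : ∀ l, π (t (.inr l) (.inl j)) = 0 := fun l => congrFun (hrow l) j
    simp [hI0 _ (heI _), h3]
  have hle : Submodule.span k (Set.range fun i => e (.inl i)) ≤ J.restrictScalars k := by
    rw [Submodule.span_le]
    rintro _ ⟨j, rfl⟩
    exact heJ j
  exact hle hfe

end HopfAlgebra

/-! ### The Hopf algebra of invariant functions -/

/-- With K the kernel of `l`, this is (K ⊗ V) ∩ (V ⊗ K) = K ⊗ K, by flatness applied to one factor
at a time. -/
theorem TensorProduct.mem_range_map_ker {k V W : Type*} [Field k] [AddCommGroup V] [Module k V]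
    [AddCommGroup W] [Module k W] (l : V →ₗ[k] W) (z : V ⊗[k] V) (h₁ : l.rTensor V z = 0)
    (h₂ : l.lTensor V z = 0) :
    z ∈ LinearMap.range (TensorProduct.map (LinearMap.ker l).subtype (LinearMap.ker l).subtype) := by
  have hex := LinearMap.exact_subtype_ker_map l
  obtain ⟨y, rfl⟩ := (Module.Flat.rTensor_exact V hex z).mp h₁
  have h₃ : (LinearMap.ker l).subtype.rTensor W (l.lTensor (LinearMap.ker l) y) = 0 := by
    rw [← h₂]
    simp only [← LinearMap.comp_apply, LinearMap.rTensor_comp_lTensor,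
      LinearMap.lTensor_comp_rTensor]
  have h₄ : l.lTensor (LinearMap.ker l) y = 0 :=
    Module.Flat.rTensor_preserves_injective_linearMap _ (Submodule.injective_subtype _)
      (h₃.trans (map_zero _).symm)
  obtain ⟨x, rfl⟩ := (Module.Flat.lTensor_exact (LinearMap.ker l) hex y).mp h₄
  exact ⟨x, by simp only [← LinearMap.comp_apply, LinearMap.rTensor_comp_lTensor]⟩

theorem mul_conj_inv {Γ : Type*} [Group Γ] (x y z : Γ) :
    x * z * (z⁻¹ * y * z⁻¹⁻¹) = x * y * z := by
  group

namespace HopfAlgebra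

open WithConv Coalgebra

theorem Point.map_comul {k A R S : Type*} [CommRing k] [CommRing A] [HopfAlgebra k A] [CommRing R]
    [Algebra k R] [CommRing S] [Algebra k S] (g : Point k A R) (h : Point k A S) (a : A) :
    Algebra.TensorProduct.map g.ofConv h.ofConv (comul a) =
      (Point.map Algebra.TensorProduct.includeLeft g *
        Point.map Algebra.TensorProduct.includeRight h : Point k A (R ⊗[k] S)) a := by
  rw [AlgHom.convMul_apply]
  refine DFunLike.congr_fun (?_ : Algebra.TensorProduct.map g.ofConv h.ofConv = _) _
  ext <;> simp [Point.map]

/-- Restriction of points along a morphism of algebras compatible with comultiplication. -/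
noncomputable def Point.comap {k A B R : Type*} [CommRing k] [CommRing A] [HopfAlgebra k A] [CommRing B]
    [HopfAlgebra k B] [CommRing R] [Algebra k R] (θ : B →ₐ[k] A)
    (hθ : ∀ b, Algebra.TensorProduct.map θ θ (comul b) = comul (θ b)) :
    Point k A R →* Point k B R :=
  MonoidHom.mk' (fun g => toConv (g.ofConv.comp θ)) fun g h => by
    ext b
    change (g * h) (θ b) = (toConv (g.ofConv.comp θ) * toConv (h.ofConv.comp θ)) b
    rw [AlgHom.convMul_apply, AlgHom.convMul_apply, ← hθ]
    generalize comul (R := k) b = w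
    induction w with
    | zero => simp
    | add x y hx hy => simp only [map_add, hx, hy]
    | tmul x y => simp

variable {k A : Type u} [Field k] [CommRing A] [HopfAlgebra k A]

section Generic

variable (k) (I : Ideal A)

/-- The generic point of the affine group scheme, over `A ⊗ A / I`. -/
def genericPoint : Point k A (A ⊗[k] (A ⧸ I)) := toConv Algebra.TensorProduct.includeLeft

/-- The generic point of the closed subscheme defined by `I`, over `A ⊗ A / I`. -/
def genericSubPoint : Point k A (A ⊗[k] (A ⧸ I)) :=
  toConv (Algebra.TensorProduct.includeRight.comp (Ideal.Quotient.mkₐ k I))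

theorem genericSubPoint_apply {i : A} (hi : i ∈ I) : genericSubPoint k I i = 0 := by
  simp [genericSubPoint, Ideal.Quotient.eq_zero_iff_mem.mpr hi]

/-- A point together with a point of the closed subscheme defined by `I` is a specialization of
the generic pair. -/
theorem exists_specialization {R : Type*} [CommRing R] [Algebra k R] (g n : Point k A R)
    (hn : ∀ i ∈ I, n i = 0) : ∃ φ : A ⊗[k] (A ⧸ I) →ₐ[k] R,
      Point.map φ (genericPoint k I) = g ∧ Point.map φ (genericSubPoint k I) = n := by
  refine ⟨Algebra.TensorProduct.lift g.ofConv (Ideal.Quotient.liftₐ I n.ofConv hn)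
    fun _ _ => Commute.all _ _, ?_, ?_⟩
  · ext a
    simp [genericPoint]
  · ext a
    simp [genericSubPoint]
    rfl

variable {k I}

/-- Every pair specializes from the generic one, so a single equation suffices. It exhibits the
invariants as an equalizer of two algebra morphisms. -/
theorem mem_invariants_iff {a : A} : a ∈ invariants k I ↔
    (genericPoint k I * genericSubPoint k I) a = genericPoint k I a := by
  refine ⟨fun h => h _ _ _ fun i hi => genericSubPoint_apply k I hi, fun h R _ _ g n hn => ?_⟩
  obtain ⟨φ, rfl, rfl⟩ := exists_specialization k I g n hn
  rw [← map_mul, Point.map_apply, h, Point.map_apply]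

end Generic

variable {I : Ideal A}

theorem mem_range_map_equalizer {R : Type*} [CommRing R] [Algebra k R] (ψ₁ ψ₂ : A →ₐ[k] R)
    {z : A ⊗[k] A}
    (h₁ : Algebra.TensorProduct.map ψ₁ (.id k A) z = Algebra.TensorProduct.map ψ₂ (.id k A) z)
    (h₂ : Algebra.TensorProduct.map (.id k A) ψ₁ z = Algebra.TensorProduct.map (.id k A) ψ₂ z) :
    z ∈ (Algebra.TensorProduct.map (AlgHom.equalizer ψ₁ ψ₂).val
      (AlgHom.equalizer ψ₁ ψ₂).val).range := by
  let l : A →ₗ[k] R := ψ₁.toLinearMap - ψ₂.toLinearMap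
  have hl : ∀ a : LinearMap.ker l, (a : A) ∈ AlgHom.equalizer ψ₁ ψ₂ := fun a =>
    sub_eq_zero.mp a.2
  obtain ⟨w, rfl⟩ := TensorProduct.mem_range_map_ker l z
    (by
      rw [LinearMap.rTensor_sub]
      exact sub_eq_zero.mpr h₁)
    (by
      rw [LinearMap.lTensor_sub]
      exact sub_eq_zero.mpr h₂)
  clear h₁ h₂
  induction w with
  | zero => simp
  | add x y hx hy => rw [map_add]; exact add_mem hx hy
  | tmul p q => exact ⟨⟨p, hl p⟩ ⊗ₜ ⟨q, hl q⟩, by simp⟩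

/-- Since the invariants form an equalizer, it suffices that `comul b` is invariant in each factor
separately, i.e. that the function b(xz) is invariant in each variable. -/
theorem comul_invariants (hI : IsNormalIdeal k I) {b : A} (hb : b ∈ invariants k I) :
    comul b ∈ (Algebra.TensorProduct.map (invariants k I).val (invariants k I).val).range := by
  have hB : invariants k I = AlgHom.equalizer (genericPoint k I * genericSubPoint k I).ofConv
      (genericPoint k I).ofConv := Subalgebra.ext fun a => mem_invariants_iff
  have hy : ∀ i ∈ I, genericSubPoint k I i = 0 := fun i hi => genericSubPoint_apply k I hi
  have key : ∀ {R : Type u} [CommRing R] [Algebra k R] (x y : Point k A R),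
      (∀ i ∈ I, y i = 0) → Algebra.TensorProduct.map (x * y).ofConv (.id k A) (comul b) =
        Algebra.TensorProduct.map x.ofConv (.id k A) (comul b) ∧
      Algebra.TensorProduct.map (.id k A) (x * y).ofConv (comul b) =
        Algebra.TensorProduct.map (.id k A) x.ofConv (comul b) := by
    intro R _ _ x y hy
    let id : Point k A A := toConv (.id k A)
    constructor
    · have e₁ := Point.map_comul (x * y) id b
      have e₂ := Point.map_comul x id b
      refine e₁.trans (Eq.trans ?_ e₂.symm)
      obtain ⟨N, hN, hNI⟩ := hI (R ⊗[k] A)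
      generalize Point.map (Algebra.TensorProduct.includeRight : A →ₐ[k] R ⊗[k] A) id = z
      have hn : Point.map (Algebra.TensorProduct.includeLeft : R →ₐ[k] R ⊗[k] A) y ∈ N :=
        (hNI _).mpr fun i hi => by rw [Point.map_apply, hy i hi, map_zero]
      -- Here the subgroup point sits in the middle of the product; normality moves it to the right
      -- end as a conjugate.
      rw [map_mul, ← mul_conj_inv]
      exact hb _ _ _ ((hNI _).mp (hN.conj_mem _ hn z⁻¹))
    · have e₁ := Point.map_comul id (x * y) b
      have e₂ := Point.map_comul id x b
      refine e₁.trans (Eq.trans ?_ e₂.symm)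
      rw [map_mul, ← mul_assoc]
      exact hb _ _ _ fun i hi => by rw [Point.map_apply, hy i hi, map_zero]
  rw [hB]
  exact mem_range_map_equalizer _ _ (key _ _ hy).1 (key _ _ hy).2

theorem antipode_mem_invariants (hI : IsNormalIdeal k I) {b : A} (hb : b ∈ invariants k I) :
    antipode k b ∈ invariants k I := by
  intro R _ _ g n hn
  obtain ⟨N, hN, hNI⟩ := hI R
  have hc := (hNI _).mp (hN.conj_mem _ (N.inv_mem ((hNI n).mpr hn)) g)
  rw [← Point.inv_apply, ← Point.inv_apply, ← hb R g⁻¹ _ hc]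
  congr 1
  group

namespace invariants

theorem map_val_injective : Function.Injective
    (Algebra.TensorProduct.map (invariants k I).val (invariants k I).val) :=
  TensorProduct.map_injective_of_flat_flat (invariants k I).val.toLinearMap
    (invariants k I).val.toLinearMap Subtype.val_injective Subtype.val_injective

variable (hI : IsNormalIdeal k I)

/-- The comultiplication of the algebra of invariant functions. -/
noncomputable def comulHom : invariants k I →ₐ[k] invariants k I ⊗[k] invariants k I :=
  (AlgEquiv.ofInjective _ (map_val_injective (k := k) (I := I))).symm.toAlgHom.comp
    (((Bialgebra.comulAlgHom k A).comp (invariants k I).val).codRestrict _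
      fun b => comul_invariants hI b.2)

theorem map_val_comulHom (b : invariants k I) :
    Algebra.TensorProduct.map (invariants k I).val (invariants k I).val (comulHom hI b) =
      comul (b : A) :=
  congrArg Subtype.val ((AlgEquiv.ofInjective _ (map_val_injective (k := k) (I := I))).apply_symm_apply
    (((Bialgebra.comulAlgHom k A).comp (invariants k I).val).codRestrict _
      (fun b => comul_invariants hI b.2) b))

/-- The bialgebra structure on invariant functions. -/
noncomputable abbrev bialgebra : Bialgebra k (invariants k I) :=
  Bialgebra.ofAlgHom (comulHom hI) ((Bialgebra.counitAlgHom k A).comp (invariants k I).val)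
    (by
      let v := (invariants k I).val
      let v₂ := Algebra.TensorProduct.map v v
      let v₃ := Algebra.TensorProduct.map v v₂
      have hv₃ : Function.Injective v₃ :=
        TensorProduct.map_injective_of_flat_flat v.toLinearMap v₂.toLinearMap
          Subtype.val_injective map_val_injective
      have h : v₂.comp (comulHom hI) = (Bialgebra.comulAlgHom k A).comp v :=
        AlgHom.ext (map_val_comulHom hI)
      have h₁ : v₃.comp ((Algebra.TensorProduct.assoc k k k _ _ _).toAlgHom.comp
          (Algebra.TensorProduct.map (comulHom hI) (.id k _))) =
          ((Algebra.TensorProduct.assoc k k k A A A).toAlgHom.comp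
          (Algebra.TensorProduct.map (Bialgebra.comulAlgHom k A) (.id k A))).comp v₂ := by
        have h₀ : v₃.comp (Algebra.TensorProduct.assoc k k k _ _ _).toAlgHom =
          (Algebra.TensorProduct.assoc k k k A A A).toAlgHom.comp
            (Algebra.TensorProduct.map v₂ v) := by ext <;> rfl
        rw [← AlgHom.comp_assoc, h₀, AlgHom.comp_assoc, AlgHom.comp_assoc,
          ← Algebra.TensorProduct.map_comp, ← Algebra.TensorProduct.map_comp, h]
        rfl
      have h₂ : v₃.comp (Algebra.TensorProduct.map (.id k _) (comulHom hI)) =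
          (Algebra.TensorProduct.map (.id k A) (Bialgebra.comulAlgHom k A)).comp v₂ := by
        rw [← Algebra.TensorProduct.map_comp, ← Algebra.TensorProduct.map_comp, h]
        rfl
      -- The triple tensor power of the inclusion is injective, so coassociativity can be read off
      -- in `A`.
      refine (AlgHom.cancel_left hv₃).mp ?_
      have h₃ : ∀ {C D : Type u} [Semiring C] [Algebra k C] [Semiring D] [Algebra k D]
          (f : D →ₐ[k] C) (p : invariants k I ⊗[k] invariants k I →ₐ[k] D)
          (q : A ⊗[k] A →ₐ[k] C), f.comp p = q.comp v₂ → f.comp (p.comp (comulHom hI)) =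
            (q.comp (Bialgebra.comulAlgHom k A)).comp v := by
        intro C D _ _ _ _ f p q hpq
        rw [← AlgHom.comp_assoc, hpq, AlgHom.comp_assoc, h, AlgHom.comp_assoc]
      have e₁ := h₃ _ _ _ h₁
      have e₂ := h₃ _ _ _ h₂
      refine e₁.trans (Eq.trans ?_ e₂.symm)
      ext a
      exact coassoc_apply (R := k) (a : A))
    (by
      let v := (invariants k I).val
      have h : (Algebra.TensorProduct.map v v).comp (comulHom hI) =
        (Bialgebra.comulAlgHom k A).comp v := AlgHom.ext (map_val_comulHom hI)
      have hv : Function.Injective (Algebra.TensorProduct.map (.id k k) v) :=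
        TensorProduct.map_injective_of_flat_flat LinearMap.id v.toLinearMap
          Function.injective_id Subtype.val_injective
      refine (AlgHom.cancel_left hv).mp ?_
      have h₁ : (Algebra.TensorProduct.map (.id k k) v).comp (Algebra.TensorProduct.map
          ((Bialgebra.counitAlgHom k A).comp v) (.id k _)) =
          (Algebra.TensorProduct.map (Bialgebra.counitAlgHom k A) (.id k A)).comp
            (Algebra.TensorProduct.map v v) := by
        rw [← Algebra.TensorProduct.map_comp, ← Algebra.TensorProduct.map_comp]
        rfl
      rw [← AlgHom.comp_assoc, h₁, AlgHom.comp_assoc, h]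
      ext a
      exact rTensor_counit_comul (R := k) (a : A))
    (by
      let v := (invariants k I).val
      have h : (Algebra.TensorProduct.map v v).comp (comulHom hI) =
        (Bialgebra.comulAlgHom k A).comp v := AlgHom.ext (map_val_comulHom hI)
      have hv : Function.Injective (Algebra.TensorProduct.map v (.id k k)) :=
        TensorProduct.map_injective_of_flat_flat v.toLinearMap LinearMap.id
          Subtype.val_injective Function.injective_id
      refine (AlgHom.cancel_left hv).mp ?_
      have h₁ : (Algebra.TensorProduct.map v (.id k k)).comp (Algebra.TensorProduct.map
          (.id k _) ((Bialgebra.counitAlgHom k A).comp v)) =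
          (Algebra.TensorProduct.map (.id k A) (Bialgebra.counitAlgHom k A)).comp
            (Algebra.TensorProduct.map v v) := by
        rw [← Algebra.TensorProduct.map_comp, ← Algebra.TensorProduct.map_comp]
        rfl
      rw [← AlgHom.comp_assoc, h₁, AlgHom.comp_assoc, h]
      ext a
      exact lTensor_counit_comul (R := k) (a : A))

/-- The antipode of the algebra of invariant functions. -/
noncomputable def antipodeHom : invariants k I →ₐ[k] invariants k I :=
  ((antipodeAlgHom k A).comp (invariants k I).val).codRestrict _
    fun b => antipode_mem_invariants hI b.2

/-- The Hopf algebra structure on invariant functions. -/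
noncomputable abbrev hopfAlgebra : HopfAlgebra k (invariants k I) :=
  letI := bialgebra hI
  HopfAlgebra.ofAlgHom (antipodeHom hI)
    (by
      let v := (invariants k I).val
      have h : (Algebra.TensorProduct.map v v).comp (comulHom hI) =
        (Bialgebra.comulAlgHom k A).comp v := AlgHom.ext (map_val_comulHom hI)
      have h₁ : v.comp (Algebra.TensorProduct.lift (antipodeHom hI) (.id k _) fun _ => Commute.all _) =
          (Algebra.TensorProduct.lift (antipodeAlgHom k A) (.id k A)
            fun _ => Commute.all _).comp (Algebra.TensorProduct.map v v) := by
        refine Algebra.TensorProduct.ext' fun a b => ?_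
        simp only [AlgHom.comp_apply, Algebra.TensorProduct.map_tmul]
        rfl
      have hv : Function.Injective v := Subtype.val_injective
      refine (AlgHom.cancel_left hv).mp ?_
      rw [← AlgHom.comp_assoc, h₁]
      change (AlgHom.comp _ _).comp (comulHom hI) = _
      rw [AlgHom.comp_assoc, h]
      ext a
      have h₂ := congrArg (fun g : Point k A A => g (a : A))
        (inv_mul_cancel (toConv (AlgHom.id k A) : Point k A A))
      simp only [AlgHom.convMul_apply] at h₂
      exact h₂)
    (by
      let v := (invariants k I).val
      have h : (Algebra.TensorProduct.map v v).comp (comulHom hI) =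
        (Bialgebra.comulAlgHom k A).comp v := AlgHom.ext (map_val_comulHom hI)
      have h₁ : v.comp (Algebra.TensorProduct.lift (.id k _) (antipodeHom hI) fun _ _ => Commute.all _ _) =
          (Algebra.TensorProduct.lift (.id k A) (antipodeAlgHom k A)
            fun _ _ => Commute.all _ _).comp (Algebra.TensorProduct.map v v) := by
        refine Algebra.TensorProduct.ext' fun a b => ?_
        simp only [AlgHom.comp_apply, Algebra.TensorProduct.map_tmul]
        rfl
      have hv : Function.Injective v := Subtype.val_injective
      refine (AlgHom.cancel_left hv).mp ?_
      rw [← AlgHom.comp_assoc, h₁]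
      change (AlgHom.comp _ _).comp (comulHom hI) = _
      rw [AlgHom.comp_assoc, h]
      ext a
      have h₂ := congrArg (fun g : Point k A A => g (a : A))
        (mul_inv_cancel (toConv (AlgHom.id k A) : Point k A A))
      simp only [AlgHom.convMul_apply] at h₂
      exact h₂)

end invariants

end HopfAlgebra

/-! ### Tensor products of difference algebras and bialgebras from generic points -/

/-- The ring homomorphism out of a tensor product given by two ring homomorphisms agreeing on the
base ring. -/
noncomputable def Algebra.TensorProduct.liftRingHom {k R S T : Type*} [CommRing k] [CommRing R]
    [CommRing S] [CommRing T] [Algebra k R] [Algebra k S] (f : R →+* T) (g : S →+* T)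
    (h : ∀ c, f (algebraMap k R c) = g (algebraMap k S c)) : R ⊗[k] S →+* T :=
  -- The intended maps involve `σ` and are only semilinear over `k`, so `T` receives a twisted
  -- `k`-structure through `f`.
  letI : Algebra k T := (f.comp (algebraMap k R)).toAlgebra
  (Algebra.TensorProduct.lift (⟨f, fun _ => rfl⟩ : R →ₐ[k] T) (⟨g, fun c => (h c).symm⟩ : S →ₐ[k] T)
    fun _ _ => Commute.all _ _).toRingHom

theorem Algebra.TensorProduct.liftRingHom_tmul {k R S T : Type*} [CommRing k] [CommRing R]
    [CommRing S] [CommRing T] [Algebra k R] [Algebra k S] (f : R →+* T) (g : S →+* T)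
    (h : ∀ c, f (algebraMap k R c) = g (algebraMap k S c)) (r : R) (s : S) :
    Algebra.TensorProduct.liftRingHom f g h (r ⊗ₜ s) = f r * g s := by
  let _ : Algebra k T := (f.comp (algebraMap k R)).toAlgebra
  exact Algebra.TensorProduct.lift_tmul _ _ _ _ _

section

variable {k A : Type*} [CommRing k] [CommRing A] [Algebra k A] (Δ : A →ₐ[k] A ⊗[k] A)
  (e : A →ₐ[k] k) (S : A →ₐ[k] A)

/-- The algebra morphism out of a tensor product of commutative algebras with given components. -/
noncomputable abbrev Algebra.TensorProduct.desc {R S T : Type*} [CommRing R] [CommRing S]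
    [CommRing T] [Algebra k R] [Algebra k S] [Algebra k T] (f : R →ₐ[k] T) (g : S →ₐ[k] T) :
    R ⊗[k] S →ₐ[k] T :=
  Algebra.TensorProduct.lift f g fun _ _ => Commute.all _ _

open Algebra.TensorProduct in
/-- A bialgebra structure given by the group laws on generic points. -/
noncomputable abbrev Bialgebra.ofGeneric
    (hassoc : (desc ((desc includeLeft (includeRight.comp includeLeft)).comp Δ)
        (includeRight.comp includeRight)).comp Δ = (desc (includeLeft : A →ₐ[k] A ⊗[k] (A ⊗[k] A))
        ((desc (includeRight.comp includeLeft) (includeRight.comp includeRight)).comp Δ)).comp Δ)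
    (hone : (desc ((Algebra.ofId k A).comp e) (.id k A)).comp Δ = .id k A)
    (hone' : (desc (.id k A) ((Algebra.ofId k A).comp e)).comp Δ = .id k A) :
    Bialgebra k A :=
  Bialgebra.ofAlgHom Δ e
    (by
      have h₁ : (Algebra.TensorProduct.assoc k k k A A A).toAlgHom.comp
          (Algebra.TensorProduct.map Δ (.id k A)) =
          desc ((desc includeLeft (includeRight.comp includeLeft)).comp Δ)
            (includeRight.comp includeRight) := by
        refine Algebra.TensorProduct.ext' fun a b => ?_
        simp only [AlgHom.comp_apply, map_tmul, lift_tmul]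
        generalize Δ a = w
        induction w with
        | zero => simp
        | add x y hx hy => simp only [map_add, TensorProduct.add_tmul, hx, hy, add_mul]
        | tmul x y => simp
      have h₂ : Algebra.TensorProduct.map (.id k A) Δ = desc (includeLeft : A →ₐ[k] _)
          ((desc (includeRight.comp includeLeft) (includeRight.comp includeRight)).comp Δ) := by
        refine Algebra.TensorProduct.ext' fun a b => ?_
        simp only [AlgHom.comp_apply, map_tmul, lift_tmul]
        generalize Δ b = w
        induction w with
        | zero => simp
        | add x y hx hy => simp only [map_add, TensorProduct.tmul_add, hx, hy, mul_add]
        | tmul x y => simp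
      rw [← AlgHom.comp_assoc, h₁, hassoc, h₂])
    (by
      ext a
      refine (Algebra.TensorProduct.lid k A).injective ?_
      refine Eq.trans ?_ ((DFunLike.congr_fun hone a).trans
        ((Algebra.TensorProduct.lid k A).apply_symm_apply a).symm)
      simp only [AlgHom.comp_apply]
      generalize Δ a = w
      induction w with
      | zero => simp
      | add x y hx hy => simp only [map_add, hx, hy]
      | tmul x y => simp [Algebra.smul_def, Algebra.ofId_apply])
    (by
      ext a
      refine (Algebra.TensorProduct.rid k k A).injective ?_
      refine Eq.trans ?_ ((DFunLike.congr_fun hone' a).trans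
        ((Algebra.TensorProduct.rid k k A).apply_symm_apply a).symm)
      simp only [AlgHom.comp_apply]
      generalize Δ a = w
      induction w with
      | zero => simp
      | add x y hx hy => simp only [map_add, hx, hy]
      | tmul x y => simp [Algebra.smul_def, Algebra.ofId_apply, mul_comm])

end

/-! ### Coordinate rings of group `k`-`σ`-schemes as Hopf algebras -/

namespace DifferenceAlgebra

variable {k : Type u} [Field k] [SigmaRing k]

namespace SigmaAlg

variable {R S T U : SigmaAlg k}

/-- The underlying algebra morphism of a morphism of `k`-`σ`-algebras. -/
abbrev algHom (f : R ⟶ S) : R →ₐ[k] S := Hom.toAlgHom f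

theorem hom_ext {f g : R ⟶ S} (h : algHom f = algHom g) : f = g := Hom.ext h

theorem algHom_sigma (f : R ⟶ S) (r : R) : algHom f (σ r) = σ (algHom f r) := Hom.map_sigma f r

variable (R S) in
theorem includeLeft_sigma_algebraMap (c : k) :
    ((Algebra.TensorProduct.includeLeft : R →ₐ[k] R ⊗[k] S).toRingHom.comp σ) (algebraMap k R c) =
      ((Algebra.TensorProduct.includeRight : S →ₐ[k] R ⊗[k] S).toRingHom.comp σ)
        (algebraMap k S c) := by
  simp only [RingHom.comp_apply, R.sigma_algebraMap, S.sigma_algebraMap]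
  exact (AlgHom.commutes _ _).trans (AlgHom.commutes _ _).symm

/-- The endomorphism of a tensor product. -/
noncomputable instance : SigmaRing (R ⊗[k] S) where
  sigma := Algebra.TensorProduct.liftRingHom _ _ (includeLeft_sigma_algebraMap R S)

theorem sigma_tmul (r : R) (s : S) : (σ (r ⊗ₜ s : R ⊗[k] S) : R ⊗[k] S) = σ r ⊗ₜ σ s :=
  (Algebra.TensorProduct.liftRingHom_tmul _ _ (includeLeft_sigma_algebraMap R S) r s).trans
    (by simp)

variable (R S) in
/-- The tensor product of `k`-`σ`-algebras. -/
noncomputable abbrev tensor : SigmaAlg k where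
  carrier := R ⊗[k] S
  sigma_algebraMap c := by
    rw [Algebra.TensorProduct.algebraMap_apply, sigma_tmul, map_one, R.sigma_algebraMap]
    rfl

variable (R S) in
/-- The first inclusion into the tensor product. -/
noncomputable def inl : R ⟶ tensor R S where
  toAlgHom := Algebra.TensorProduct.includeLeft
  map_sigma r := by
    rw [Algebra.TensorProduct.includeLeft_apply, Algebra.TensorProduct.includeLeft_apply,
      sigma_tmul, map_one]

variable (R S) in
/-- The second inclusion into the tensor product. -/
noncomputable def inr : S ⟶ tensor R S where
  toAlgHom := Algebra.TensorProduct.includeRight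
  map_sigma r := by
    rw [Algebra.TensorProduct.includeRight_apply, Algebra.TensorProduct.includeRight_apply,
      sigma_tmul, map_one]

/-- The morphism out of a tensor product given by its two components. -/
noncomputable def desc (f : R ⟶ T) (g : S ⟶ T) : tensor R S ⟶ T where
  toAlgHom := Algebra.TensorProduct.desc (algHom f) (algHom g)
  map_sigma w := by
    induction w using TensorProduct.induction_on with
    | zero => simp
    | add x y hx hy => simp only [map_add, hx, hy]
    | tmul x y =>
      rw [sigma_tmul, Algebra.TensorProduct.lift_tmul, Algebra.TensorProduct.lift_tmul, map_mul,
        algHom_sigma, algHom_sigma]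

theorem inl_desc (f : R ⟶ T) (g : S ⟶ T) : inl R S ≫ desc f g = f :=
  hom_ext (Algebra.TensorProduct.lift_comp_includeLeft (algHom f) (algHom g)
    fun _ _ => Commute.all _ _)

theorem inr_desc (f : R ⟶ T) (g : S ⟶ T) : inr R S ≫ desc f g = g :=
  hom_ext (Algebra.TensorProduct.lift_comp_includeRight (algHom f) (algHom g)
    fun _ _ => Commute.all _ _)

/-- The base field as a `k`-`σ`-algebra. -/
abbrev base : SigmaAlg k where
  carrier := k
  sigma_algebraMap _ := rfl

/-- The structure morphism of a `k`-`σ`-algebra. -/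
def ofBase (R : SigmaAlg k) : base ⟶ R where
  toAlgHom := Algebra.ofId k R
  map_sigma c := (R.sigma_algebraMap c).symm

end SigmaAlg

open SigmaAlg

namespace GroupSigmaScheme

variable (G H : GroupSigmaScheme k) {S T : SigmaAlg k}

/-- The coordinate ring `k{G}`. -/
noncomputable abbrev coordRing : SigmaAlg k := G.points.coreprX

/-- The element of `G(S)` given by a morphism `k{G} → S`. -/
noncomputable def elt (f : G.coordRing ⟶ S) : G.toFunctor.obj S := G.points.coreprW.hom.app S f

/-- The morphism `k{G} → S` given by an element of `G(S)`. -/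
noncomputable def coord (x : G.toFunctor.obj S) : G.coordRing ⟶ S := G.points.coreprW.inv.app S x

variable {G}

theorem coord_elt (f : G.coordRing ⟶ S) : G.coord (G.elt f) = f :=
  ConcreteCategory.congr_hom (G.points.coreprW.hom_inv_id_app S) f

theorem elt_coord (x : G.toFunctor.obj S) : G.elt (G.coord x) = x :=
  ConcreteCategory.congr_hom (G.points.coreprW.inv_hom_id_app S) x

theorem map_elt (f : G.coordRing ⟶ S) (φ : S ⟶ T) :
    (G.toFunctor.map φ).hom (G.elt f) = G.elt (f ≫ φ) :=
  (ConcreteCategory.congr_hom (G.points.coreprW.hom.naturality φ) f).symm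

theorem coord_map (x : G.toFunctor.obj S) (φ : S ⟶ T) :
    G.coord ((G.toFunctor.map φ).hom x) = G.coord x ≫ φ :=
  ConcreteCategory.congr_hom (G.points.coreprW.inv.naturality φ) x

theorem coord_injective : Function.Injective (G.coord : G.toFunctor.obj S → _) :=
  Function.LeftInverse.injective elt_coord

variable (G)

/-- The comultiplication of `k{G}`. -/
noncomputable def comulHom : G.coordRing ⟶ tensor G.coordRing G.coordRing :=
  G.coord (G.elt (inl _ _) * G.elt (inr _ _))

/-- The counit of `k{G}`. -/
noncomputable def counitHom : G.coordRing ⟶ base := G.coord 1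

/-- The antipode of `k{G}`. -/
noncomputable def antipodeHom : G.coordRing ⟶ G.coordRing := G.coord (G.elt (𝟙 _))⁻¹

variable {G}

theorem coord_mul (x y : G.toFunctor.obj S) :
    G.coord (x * y) = G.comulHom ≫ desc (G.coord x) (G.coord y) := by
  rw [comulHom, ← coord_map, map_mul, map_elt, map_elt, inl_desc, inr_desc, elt_coord, elt_coord]

theorem coord_one : G.coord (1 : G.toFunctor.obj S) = G.counitHom ≫ ofBase S := by
  rw [counitHom, ← coord_map, map_one]

theorem comulHom_desc (f g : G.coordRing ⟶ S) :
    G.comulHom ≫ desc f g = G.coord (G.elt f * G.elt g) := by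
  rw [coord_mul, coord_elt, coord_elt]

variable (G)

/-- The bialgebra structure on `k{G}`. -/
noncomputable abbrev bialgebra : Bialgebra k G.coordRing :=
  Bialgebra.ofGeneric (algHom G.comulHom) (algHom G.counitHom)
    (by
      -- Coassociativity is the associative law in `G` for the three generic elements over the
      -- triple tensor product.
      let A := G.coordRing
      let p₁ := inl A (tensor A A)
      let p₂ := inl A A ≫ inr A (tensor A A)
      let p₃ := inr A A ≫ inr A (tensor A A)
      have h : G.comulHom ≫ desc (G.comulHom ≫ desc p₁ p₂) p₃ =
          G.comulHom ≫ desc p₁ (G.comulHom ≫ desc p₂ p₃) := by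
        simp only [comulHom_desc, elt_coord, mul_assoc]
      exact congrArg algHom h)
    (by
      have h : G.comulHom ≫ desc (G.counitHom ≫ ofBase _) (𝟙 _) = 𝟙 _ := by
        rw [comulHom_desc, ← coord_one, elt_coord, one_mul, coord_elt]
      exact congrArg algHom h)
    (by
      have h : G.comulHom ≫ desc (𝟙 _) (G.counitHom ≫ ofBase _) = 𝟙 _ := by
        rw [comulHom_desc, ← coord_one, elt_coord, mul_one, coord_elt]
      exact congrArg algHom h)

/-- The Hopf algebra structure on `k{G}`. -/
noncomputable instance hopfAlgebra : HopfAlgebra k G.coordRing :=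
  letI := G.bialgebra
  HopfAlgebra.ofAlgHom (algHom G.antipodeHom)
    (by
      have h : G.comulHom ≫ desc G.antipodeHom (𝟙 _) = G.counitHom ≫ ofBase _ := by
        rw [comulHom_desc, ← coord_one, antipodeHom, elt_coord, inv_mul_cancel]
      exact congrArg algHom h)
    (by
      have h : G.comulHom ≫ desc (𝟙 _) G.antipodeHom = G.counitHom ≫ ofBase _ := by
        rw [comulHom_desc, ← coord_one, antipodeHom, elt_coord, mul_inv_cancel]
      exact congrArg algHom h)

open WithConv HopfAlgebra

theorem comul_apply (a : G.coordRing) :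
    Coalgebra.comul (R := k) a = algHom G.comulHom a := rfl

/-- The point of the affine group scheme underlying `k{G}` given by an element of `G(S)`. -/
noncomputable def toPoint (S : SigmaAlg k) : G.toFunctor.obj S →* Point k G.coordRing S :=
  MonoidHom.mk' (fun x => toConv (algHom (G.coord x))) fun x y => by
    rw [coord_mul]
    ext a
    rw [AlgHom.convMul_apply]
    rfl

variable {G}

theorem toPoint_apply (x : G.toFunctor.obj S) (a : G.coordRing) :
    G.toPoint S x a = algHom (G.coord x) a := rfl

theorem toPoint_sigma (x : G.toFunctor.obj S) (a : G.coordRing) :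
    G.toPoint S x (σ a) = σ (G.toPoint S x a) := algHom_sigma _ _

theorem toPoint_injective : Function.Injective (G.toPoint S) := fun _ _ h =>
  coord_injective (hom_ext (congrArg ofConv h))

theorem toPoint_map (x : G.toFunctor.obj S) (φ : S ⟶ T) :
    G.toPoint T ((G.toFunctor.map φ).hom x) = Point.map (algHom φ) (G.toPoint S x) := by
  ext a
  rw [toPoint_apply, coord_map]
  rfl

theorem toPoint_elt (f : G.coordRing ⟶ S) : G.toPoint S (G.elt f) = toConv (algHom f) := by
  ext a
  rw [toPoint_apply, coord_elt]

end GroupSigmaScheme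

end DifferenceAlgebra

/-! ### Duals of morphisms, and the ideal of a normal `σ`-closed subgroup -/

namespace DifferenceAlgebra

variable {k : Type u} [Field k] [SigmaRing k]

open SigmaAlg GroupSigmaScheme WithConv HopfAlgebra

/-- The endomorphism of a tensor product of `k`-`σ`-algebras. -/
noncomputable def SigmaAlg.tensorSigma (R S : SigmaAlg k) : R ⊗[k] S →+* R ⊗[k] S := σ

theorem SigmaAlg.map_tensorSigma {R S R' S' : SigmaAlg k} (f : R ⟶ R') (g : S ⟶ S')
    (w : R ⊗[k] S) : Algebra.TensorProduct.map (algHom f) (algHom g) (tensorSigma R S w) =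
      tensorSigma R' S' (Algebra.TensorProduct.map (algHom f) (algHom g) w) := by
  induction w with
  | zero => simp
  | add x y hx hy => simp only [map_add, hx, hy]
  | tmul x y =>
    rw [tensorSigma, tensorSigma, sigma_tmul, Algebra.TensorProduct.map_tmul,
      Algebra.TensorProduct.map_tmul, sigma_tmul, algHom_sigma, algHom_sigma]

theorem SigmaIdeal.proj_eq_zero {R : SigmaAlg k} (I : SigmaIdeal R) {i : R} (hi : i ∈ I.ideal) :
    algHom I.proj i = 0 :=
  Ideal.Quotient.eq_zero_iff_mem.mpr hi

namespace GroupSigmaScheme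

variable {G H : GroupSigmaScheme k} {S : SigmaAlg k}

/-- The morphism of coordinate rings dual to a morphism of group `k`-`σ`-schemes. -/
noncomputable def coHom (φ : G.toFunctor ⟶ H.toFunctor) : H.coordRing ⟶ G.coordRing :=
  H.coord ((φ.app _).hom (G.elt (𝟙 _)))

theorem app_map (φ : G.toFunctor ⟶ H.toFunctor) {T : SigmaAlg k} (f : S ⟶ T)
    (x : G.toFunctor.obj S) : (φ.app T).hom ((G.toFunctor.map f).hom x) =
      (H.toFunctor.map f).hom ((φ.app S).hom x) :=
  ConcreteCategory.congr_hom (φ.naturality f) x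

theorem coord_app (φ : G.toFunctor ⟶ H.toFunctor) (x : G.toFunctor.obj S) :
    H.coord ((φ.app S).hom x) = coHom φ ≫ G.coord x := by
  rw [coHom, ← coord_map, ← app_map, map_elt, Category.id_comp, elt_coord]

theorem toPoint_app (φ : G.toFunctor ⟶ H.toFunctor) (x : G.toFunctor.obj S) (a : H.coordRing) :
    H.toPoint S ((φ.app S).hom x) a = G.toPoint S x (algHom (coHom φ) a) := by
  rw [toPoint_apply, coord_app]
  rfl

/-- This is multiplicativity of `φ` on the two generic elements of `G` over `A ⊗ A`. -/
theorem map_coHom_comul (φ : G.toFunctor ⟶ H.toFunctor) (a : H.coordRing) :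
    Algebra.TensorProduct.map (algHom (coHom φ)) (algHom (coHom φ)) (Coalgebra.comul a) =
      Coalgebra.comul (R := k) (algHom (coHom φ) a) := by
  let A := G.coordRing
  let x := G.elt (inl A A)
  let y := G.elt (inr A A)
  have h : (H.toPoint _ ((φ.app _).hom x) * H.toPoint _ ((φ.app _).hom y)) a =
      (G.toPoint _ x * G.toPoint _ y) (algHom (coHom φ) a) := by
    rw [← map_mul, ← map_mul, ← map_mul]
    exact toPoint_app φ (x * y) a
  have hx : Point.map Algebra.TensorProduct.includeLeft (toConv (algHom (coHom φ))) =
      H.toPoint (tensor A A) ((φ.app _).hom x) := WithConv.ext (AlgHom.ext fun b => by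
    rw [toPoint_app, toPoint_elt]
    rfl)
  have hy : Point.map Algebra.TensorProduct.includeRight (toConv (algHom (coHom φ))) =
      H.toPoint (tensor A A) ((φ.app _).hom y) := WithConv.ext (AlgHom.ext fun b => by
    rw [toPoint_app, toPoint_elt]
    rfl)
  have h₁ := Point.map_comul (toConv (algHom (coHom φ))) (toConv (algHom (coHom φ))) a
  have h₂ := Point.map_comul (toConv (AlgHom.id k A)) (toConv (AlgHom.id k A))
    (algHom (coHom φ) a)
  rw [hx, hy] at h₁
  rw [Algebra.TensorProduct.map_id] at h₂
  refine h₁.trans (h.trans ?_)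
  rw [toPoint_elt, toPoint_elt]
  exact h₂.symm

end GroupSigmaScheme

namespace SubgroupOf

variable {G : GroupSigmaScheme k} {N : SubgroupOf G}

theorem exists_ideal (h : IsSigmaClosed G.points N.toSubfunctor) :
    ∃ I : SigmaIdeal G.coordRing, ∀ (S : SigmaAlg k) (x : G.toFunctor.obj S),
      x ∈ N.obj S ↔ ∀ i ∈ I.ideal, G.toPoint S x i = 0 := by
  obtain ⟨I, e, he⟩ := h
  refine ⟨I, fun S x => ⟨fun hx i hi => ?_, fun hx => ?_⟩⟩
  · let y : N.toSubfunctor.toFunctor.obj S := ⟨x, hx⟩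
    have h0 := congrArg (fun f => f.app S) he
    have h1 : G.coord x = I.proj ≫ e.hom.app S y := ConcreteCategory.congr_hom h0 y
    rw [toPoint_apply, h1]
    change algHom (e.hom.app S y) (algHom I.proj i) = 0
    rw [I.proj_eq_zero hi, map_zero]
  · let f : I.quotient ⟶ S :=
      { toAlgHom := Ideal.Quotient.liftₐ I.ideal (algHom (G.coord x)) hx
        map_sigma := fun r => by
          obtain ⟨r, rfl⟩ := Ideal.Quotient.mk_surjective r
          exact algHom_sigma (G.coord x) r }
    have hf : I.proj ≫ f = G.coord x := hom_ext (AlgHom.ext fun r => rfl)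
    let y : N.toSubfunctor.toFunctor.obj S := e.inv.app S f
    have h0 := congrArg (fun f => f.app S) he
    have h1 : G.coord y.1 = I.proj ≫ e.hom.app S y := ConcreteCategory.congr_hom h0 y
    have h2 : e.hom.app S y = f := ConcreteCategory.congr_hom (e.inv_hom_id_app S) f
    rw [h2, hf] at h1
    rw [← coord_injective h1]
    exact y.2

namespace IsNormalSigmaClosed

variable (hN : N.IsNormalSigmaClosed)

/-- The defining ideal of a normal `σ`-closed subgroup. -/
noncomputable def ideal : SigmaIdeal G.coordRing := (exists_ideal hN.isSigmaClosed).choose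

theorem mem_iff {S : SigmaAlg k} {x : G.toFunctor.obj S} :
    x ∈ N.obj S ↔ ∀ i ∈ hN.ideal.ideal, G.toPoint S x i = 0 :=
  (exists_ideal hN.isSigmaClosed).choose_spec S x

/-- The generic element of `G`, over the coordinate ring of `G × N`. -/
noncomputable def genericElt : G.toFunctor.obj (tensor G.coordRing hN.ideal.quotient) :=
  G.elt (inl _ _)

/-- The generic element of `N`, over the coordinate ring of `G × N`. -/
noncomputable def genericSubElt : G.toFunctor.obj (tensor G.coordRing hN.ideal.quotient) :=
  G.elt (hN.ideal.proj ≫ inr _ _)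

theorem toPoint_genericElt :
    G.toPoint _ hN.genericElt = genericPoint k hN.ideal.ideal := toPoint_elt _

theorem toPoint_genericSubElt :
    G.toPoint _ hN.genericSubElt = genericSubPoint k hN.ideal.ideal := toPoint_elt _

theorem elt_proj_mem {S : SigmaAlg k} (f : hN.ideal.quotient ⟶ S) :
    G.elt (hN.ideal.proj ≫ f) ∈ N.obj S := by
  rw [hN.mem_iff]
  intro i hi
  rw [toPoint_elt]
  change algHom f (algHom hN.ideal.proj i) = 0
  rw [hN.ideal.proj_eq_zero hi, map_zero]

/-- An arbitrary `k`-algebra `R` carries no `σ`, so the hypotheses on `N` do not apply to it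
directly. They are applied to generic elements over rings that do carry `σ`; the resulting
identities then specialize to `R` along plain algebra morphisms. -/
theorem isNormalIdeal : IsNormalIdeal k hN.ideal.ideal := by
  intro R _ _
  let I := hN.ideal
  let C := I.quotient
  have hlift : ∀ n : Point k G.coordRing R, (∀ i ∈ I.ideal, n i = 0) →
      ∃ n' : C →ₐ[k] R, Point.map n' (toConv (algHom I.proj)) = n := fun n hn =>
    ⟨Ideal.Quotient.liftₐ I.ideal n.ofConv hn, WithConv.ext (AlgHom.ext fun _ => rfl)⟩
  refine ⟨
    { carrier := {n | ∀ i ∈ I.ideal, n i = 0}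
      mul_mem' := ?_
      one_mem' := ?_
      inv_mem' := ?_ }, ⟨?_⟩, fun n => Iff.rfl⟩
  · intro m n hm hn i hi
    obtain ⟨m, rfl⟩ := hlift m hm
    obtain ⟨n, rfl⟩ := hlift n hn
    have h := hN.mem_iff.mp ((N.obj _).mul_mem (hN.elt_proj_mem (inl C C))
      (hN.elt_proj_mem (inr C C))) i hi
    rw [map_mul, toPoint_elt, toPoint_elt] at h
    have hm' : Point.map (Algebra.TensorProduct.desc m n)
        (toConv (algHom (I.proj ≫ inl C C))) = Point.map m (toConv (algHom I.proj)) :=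
      WithConv.ext (AlgHom.ext fun a => by
        change Algebra.TensorProduct.desc m n (algHom I.proj a ⊗ₜ 1) = m (algHom I.proj a)
        rw [Algebra.TensorProduct.lift_tmul, map_one, mul_one])
    have hn' : Point.map (Algebra.TensorProduct.desc m n)
        (toConv (algHom (I.proj ≫ inr C C))) = Point.map n (toConv (algHom I.proj)) :=
      WithConv.ext (AlgHom.ext fun a => by
        change Algebra.TensorProduct.desc m n (1 ⊗ₜ algHom I.proj a) = n (algHom I.proj a)
        rw [Algebra.TensorProduct.lift_tmul, map_one, one_mul])
    rw [← hm', ← hn', ← map_mul, Point.map_apply, h, map_zero]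
  · intro i hi
    have h := hN.mem_iff.mp (N.obj base).one_mem i hi
    rw [map_one, AlgHom.convOne_apply] at h
    rw [AlgHom.convOne_apply]
    change Coalgebra.counit (R := k) i = 0 at h
    rw [h, map_zero]
  · intro n hn i hi
    obtain ⟨n, rfl⟩ := hlift n hn
    have h := hN.mem_iff.mp ((N.obj _).inv_mem (hN.elt_proj_mem (𝟙 C))) i hi
    rw [map_inv, toPoint_elt, Category.comp_id] at h
    rw [← map_inv, Point.map_apply, h, map_zero]
  · intro n hn g i hi
    obtain ⟨φ, rfl, rfl⟩ := exists_specialization k I.ideal g n hn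
    have h := hN.mem_iff.mp ((hN.normal _).conj_mem _ (hN.elt_proj_mem (inr _ _))
      hN.genericElt) i hi
    change G.toPoint _ (hN.genericElt * hN.genericSubElt * hN.genericElt⁻¹) i = 0 at h
    rw [map_mul, map_mul, map_inv, toPoint_genericElt, toPoint_genericSubElt] at h
    rw [← map_inv, ← map_mul, ← map_mul, Point.map_apply]
    exact (congrArg φ h).trans (map_zero φ)

theorem mem_invariants_iff_elt {a : G.coordRing} : a ∈ invariants k hN.ideal.ideal ↔
    G.toPoint _ (hN.genericElt * hN.genericSubElt) a = G.toPoint _ hN.genericElt a := by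
  rw [mem_invariants_iff, map_mul, toPoint_genericElt, toPoint_genericSubElt]
  exact Iff.rfl

/-- The generic pair lives over a difference algebra and its points commute with `σ`, so `σ` can be
applied to the equation that characterizes invariance. -/
theorem sigma_mem_invariants {b : G.coordRing} (hb : b ∈ invariants k hN.ideal.ideal) :
    σ b ∈ invariants k hN.ideal.ideal := by
  rw [mem_invariants_iff_elt] at hb ⊢
  rw [toPoint_sigma, toPoint_sigma, hb]

noncomputable instance : SigmaRing (invariants k hN.ideal.ideal) where
  sigma := ((σ : G.coordRing →+* G.coordRing).comp
    (invariants k hN.ideal.ideal).val.toRingHom).codRestrict _ fun b =>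
      hN.sigma_mem_invariants b.2

/-! ### The quotient, its kernel and its universal property -/

/-- The coordinate ring of the quotient. -/
noncomputable abbrev invAlg : SigmaAlg k where
  carrier := invariants k hN.ideal.ideal
  sigma_algebraMap c := Subtype.ext (G.coordRing.sigma_algebraMap c)

noncomputable instance : HopfAlgebra k hN.invAlg := invariants.hopfAlgebra hN.isNormalIdeal

/-- The inclusion of the coordinate ring of the quotient. -/
noncomputable def incl : hN.invAlg ⟶ G.coordRing where
  toAlgHom := (invariants k hN.ideal.ideal).val
  map_sigma _ := rfl

theorem incl_injective : Function.Injective (algHom hN.incl) := Subtype.val_injective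

theorem map_incl_injective :
    Function.Injective (Algebra.TensorProduct.map (algHom hN.incl) (algHom hN.incl)) :=
  invariants.map_val_injective

theorem map_incl_comul (b : hN.invAlg) :
    Algebra.TensorProduct.map (algHom hN.incl) (algHom hN.incl) (Coalgebra.comul b) =
      Coalgebra.comul (R := k) (algHom hN.incl b) :=
  invariants.map_val_comulHom hN.isNormalIdeal b

theorem comul_sigma (b : hN.invAlg) :
    Coalgebra.comul (R := k) (σ b) =
      tensorSigma hN.invAlg hN.invAlg (Coalgebra.comul (R := k) b) := by
  apply hN.map_incl_injective
  rw [map_incl_comul, map_tensorSigma, map_incl_comul, algHom_sigma, comul_apply, comul_apply,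
    algHom_sigma]
  rfl

theorem counit_sigma (b : hN.invAlg) :
    Coalgebra.counit (R := k) (σ b) = (σ (Coalgebra.counit (R := k) b) : k) :=
  algHom_sigma G.counitHom (b : G.coordRing)

theorem antipode_sigma (b : hN.invAlg) : antipode k (σ b) = σ (antipode k b) :=
  Subtype.ext (algHom_sigma G.antipodeHom (b : G.coordRing))

/-- The points of the quotient: algebra morphisms out of its coordinate ring commuting with
`σ`. -/
noncomputable def sigmaPoints (S : SigmaAlg k) : Subgroup (Point k hN.invAlg S) where
  carrier := {g | ∀ b, g (σ b) = σ (g b)}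
  mul_mem' {g h} hg hh b := by
    rw [AlgHom.convMul_apply, AlgHom.convMul_apply, comul_sigma]
    exact algHom_sigma (desc (⟨g.ofConv, hg⟩ : hN.invAlg ⟶ S) (⟨h.ofConv, hh⟩ : hN.invAlg ⟶ S)) _
  one_mem' b := by
    rw [AlgHom.convOne_apply, AlgHom.convOne_apply, counit_sigma, S.sigma_algebraMap]
  inv_mem' {g} hg b := by
    rw [Point.inv_apply, Point.inv_apply, antipode_sigma]
    exact hg _

variable {hN} in
/-- The morphism of `k`-`σ`-algebras underlying a point of the quotient. -/
def sigmaPoints.hom {S : SigmaAlg k} (g : hN.sigmaPoints S) : hN.invAlg ⟶ S := ⟨g.1.ofConv, g.2⟩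

/-- The quotient group `k`-`σ`-scheme. -/
noncomputable def quotient : GroupSigmaScheme k where
  toFunctor :=
    { obj := fun S => GrpCat.of (hN.sigmaPoints S)
      map := fun {_ T} φ => GrpCat.ofHom (MonoidHom.mk'
        (fun g => (⟨Point.map (algHom φ) g.1, (sigmaPoints.hom g ≫ φ).map_sigma⟩ :
          hN.sigmaPoints T)) fun _ _ => Subtype.ext (map_mul _ _ _))
      map_id := fun _ => rfl
      map_comp := fun _ _ => rfl }
  isCorepresentable := ⟨hN.invAlg, ⟨
    { homEquiv := fun {S} =>
        { toFun := fun f => (⟨toConv (algHom f), f.map_sigma⟩ : hN.sigmaPoints S)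
          invFun := fun g => sigmaPoints.hom g
          left_inv := fun _ => rfl
          right_inv := fun _ => rfl }
      homEquiv_comp := fun _ _ => rfl }⟩⟩

/-- The projection onto the quotient. -/
noncomputable def quotientMap : G.toFunctor ⟶ hN.quotient.toFunctor where
  app S := GrpCat.ofHom (MonoidHom.mk' (fun x =>
    (⟨Point.comap (algHom hN.incl) hN.map_incl_comul (G.toPoint S x),
      (hN.incl ≫ G.coord x).map_sigma⟩ : hN.sigmaPoints S)) fun x y =>
        Subtype.ext ((congrArg _ (map_mul (G.toPoint S) x y)).trans (map_mul _ _ _)))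
  naturality S T φ := by
    ext x
    refine Subtype.ext ?_
    change Point.comap _ _ (G.toPoint T ((G.toFunctor.map φ).hom x)) = _
    rw [toPoint_map]
    rfl

theorem quotientMap_apply {S : SigmaAlg k} (x : G.toFunctor.obj S) (b : hN.invAlg) :
    ((hN.quotientMap.app S).hom x : hN.sigmaPoints S).1 b = G.toPoint S x (algHom hN.incl b) := rfl

theorem kernel_quotientMap : kernel hN.quotientMap = N := by
  ext S x
  rw [hN.mem_iff]
  constructor
  · intro hx i hi
    have hx1 : (hN.quotientMap.app S).hom x = 1 := hx
    have hx' : ∀ b : hN.invAlg, G.toPoint S x (algHom hN.incl b) =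
        algebraMap k S (Coalgebra.counit (R := k) (algHom hN.incl b)) := fun b => by
      rw [← quotientMap_apply, hx1]
      rfl
    have hle : Ideal.span {b | b ∈ invariants k hN.ideal.ideal ∧
        Coalgebra.counit (R := k) b = 0} ≤ RingHom.ker (G.toPoint S x).ofConv := by
      rw [Ideal.span_le]
      rintro b ⟨hb, hb0⟩
      refine (hx' ⟨b, hb⟩).trans ?_
      change algebraMap k S (Coalgebra.counit (R := k) b) = 0
      rw [hb0, map_zero]
    -- An element of the kernel only kills the invariants with counit 0; that these generate an
    -- ideal containing all of `I` is what places the element in `N`.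
    exact hle (le_span_invariants hN.isNormalIdeal hi)
  · intro hx
    refine Subtype.ext (WithConv.ext (AlgHom.ext fun b => ?_))
    have h := b.2 S 1 (G.toPoint S x) hx
    rw [one_mul] at h
    exact h

section UniversalProperty

variable {H : GroupSigmaScheme k} (φ : G.toFunctor ⟶ H.toFunctor) (hφ : N ≤ kernel φ)

/-- At the generic pair, `φ` sends the element of `N` to 1, which is the equation defining
invariance. -/
theorem coHom_mem_invariants (hφ : N ≤ kernel φ) (a : H.coordRing) :
    algHom (coHom φ) a ∈ invariants k hN.ideal.ideal := by
  rw [mem_invariants_iff_elt, ← toPoint_app, ← toPoint_app, map_mul]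
  have h : (φ.app _).hom hN.genericSubElt = 1 := hφ _ (hN.elt_proj_mem _)
  rw [h, mul_one]

/-- The factorization of the dual of `φ` through the coordinate ring of the quotient. -/
noncomputable def coFactor : H.coordRing ⟶ hN.invAlg where
  toAlgHom := (algHom (coHom φ)).codRestrict _ (hN.coHom_mem_invariants φ hφ)
  map_sigma a := Subtype.ext (algHom_sigma (coHom φ) a)

theorem coFactor_incl : hN.coFactor φ hφ ≫ hN.incl = coHom φ := rfl

theorem map_coFactor_comul (a : H.coordRing) :
    Algebra.TensorProduct.map (algHom (hN.coFactor φ hφ)) (algHom (hN.coFactor φ hφ))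
      (Coalgebra.comul a) = Coalgebra.comul (R := k) (algHom (hN.coFactor φ hφ) a) := by
  apply hN.map_incl_injective
  rw [map_incl_comul, ← AlgHom.comp_apply, ← Algebra.TensorProduct.map_comp]
  exact map_coHom_comul φ a

/-- The morphism out of the quotient induced by `φ`. -/
noncomputable def factor : hN.quotient.toFunctor ⟶ H.toFunctor where
  app S := GrpCat.ofHom (MonoidHom.mk' (fun g : hN.sigmaPoints S =>
      H.elt (hN.coFactor φ hφ ≫ sigmaPoints.hom g)) fun g h => by
    apply toPoint_injective
    rw [map_mul, toPoint_elt, toPoint_elt, toPoint_elt]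
    exact map_mul (Point.comap _ (hN.map_coFactor_comul φ hφ)) g.1 h.1)
  naturality S T f := by
    ext g
    exact (map_elt (hN.coFactor φ hφ ≫ sigmaPoints.hom g) f).symm

theorem quotientMap_factor : hN.quotientMap ≫ hN.factor φ hφ = φ := by
  ext S x
  refine coord_injective (G := H) (S := S) ?_
  refine Eq.trans ?_ (coord_app φ x).symm
  exact coord_elt (G := H) (hN.coFactor φ hφ ≫ hN.incl ≫ G.coord x)

/-- By Yoneda, `ψ` is determined by its value at the universal point `g₀`. Since the invariants
embed in k{G}, that value is determined by its image there, which is fixed by `φ`. -/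
theorem eq_factor (ψ : hN.quotient.toFunctor ⟶ H.toFunctor) (hψ : hN.quotientMap ≫ ψ = φ) :
    ψ = hN.factor φ hφ := by
  let g₀ : hN.quotient.toFunctor.obj hN.invAlg :=
    (⟨toConv (AlgHom.id k hN.invAlg), fun _ => rfl⟩ : hN.sigmaPoints hN.invAlg)
  have h₀ : H.coord ((ψ.app _).hom g₀) = hN.coFactor φ hφ := by
    have h₁ : (hN.quotient.toFunctor.map hN.incl).hom g₀ =
        (hN.quotientMap.app _).hom (G.elt (𝟙 _)) := by
      refine Subtype.ext ?_
      change _ = Point.comap _ _ (G.toPoint _ (G.elt (𝟙 _)))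
      rw [toPoint_elt]
      rfl
    have h₂ : H.coord ((ψ.app _).hom g₀) ≫ hN.incl = hN.coFactor φ hφ ≫ hN.incl := by
      rw [← coord_map, ← app_map, h₁, coFactor_incl, coHom, ← hψ]
      rfl
    refine hom_ext (AlgHom.ext fun a => hN.incl_injective ?_)
    exact DFunLike.congr_fun (congrArg algHom h₂) a
  ext S g
  refine coord_injective (G := H) (S := S) ?_
  have hg : g = (hN.quotient.toFunctor.map (sigmaPoints.hom g)).hom g₀ := rfl
  have h₁ := app_map ψ (sigmaPoints.hom g) g₀
  rw [← hg] at h₁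
  rw [h₁, coord_map, h₀]
  exact (coord_elt (G := H) (hN.coFactor φ hφ ≫ sigmaPoints.hom g)).symm

theorem isQuotient_quotientMap : IsQuotient N hN.quotientMap where
  le_kernel := by
    rw [kernel_quotientMap]
    exact fun S => le_rfl
  existsUnique_factor _ φ hφ :=
    ⟨hN.factor φ hφ, hN.quotientMap_factor φ hφ, fun ψ hψ => hN.eq_factor φ hφ ψ hψ⟩

end UniversalProperty

end IsNormalSigmaClosed

end SubgroupOf

end DifferenceAlgebra

theorem mainTheorem8 {k : Type u} [Field k] [DifferenceAlgebra.SigmaRing k]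
    (G : DifferenceAlgebra.GroupSigmaScheme k) (N : DifferenceAlgebra.SubgroupOf G)
    (hN : N.IsNormalSigmaClosed) :
    (∃ (Q : DifferenceAlgebra.GroupSigmaScheme k) (π : G.toFunctor ⟶ Q.toFunctor),
      DifferenceAlgebra.IsQuotient N π) ∧
    (∀ (Q : DifferenceAlgebra.GroupSigmaScheme k) (π : G.toFunctor ⟶ Q.toFunctor),
      DifferenceAlgebra.IsQuotient N π → N = DifferenceAlgebra.kernel π) := by
  refine ⟨⟨hN.quotient, hN.quotientMap, hN.isQuotient_quotientMap⟩, fun Q π hπ => ?_⟩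
  -- Factoring the constructed projection through `π` gives `kernel π ≤ kernel hN.quotientMap`,
  -- which is `N`.
  obtain ⟨ψ, hψ, -⟩ := hπ.existsUnique_factor _ hN.quotientMap
    hN.isQuotient_quotientMap.le_kernel
  ext S x
  refine ⟨fun hx => hπ.le_kernel S hx, fun hx => ?_⟩
  rw [← hN.kernel_quotientMap, ← hψ]
  have hx' : (π.app S).hom x = 1 := hx
  change (ψ.app S).hom ((π.app S).hom x) = 1
  rw [hx', map_one]
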